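/- **Theorem (Sample Complexity Bounds).** All functions $\kappa$ below are Borel measurable and all distributions $J$ are Borel probability measures on $[0,1]\times\{0,1\}$. Write $[t]_0^1=\min(\max(t,0),1)$ and let $\mathrm{sign}_+(t)=1$ if $t\ge 0$ and $\mathrm{sign}_+(t)=-1$ if $t<0$. A class $\mathcal K$ of functions $[0,1]\to[0,1]$ is a *valid post-processing class* if it contains the identity and if, for all $\kappa\in\mathcal K$ and $s,t\in\mathbb R$, it contains $p\mapsto\big[\kappa([p+s]_0^1)+t\big]_0^1$. Let $\mathsf{thr}(\mathcal K)=\{p\mapsto \mathrm{sign}_+(\kappa(p)-\tfrac12) : \kappa\in\mathcal K\}$ and let $d=\mathsf{VCdim}(\mathsf{thr}(\mathcal K))\in\mathbb N\cup\{\infty\}$ be its VC dimension. Call $\mathsf{thr}(\mathcal K)$ a *measurable class* if for all $n$ and $\sigma\in\{\pm1\}^n$ the set of $x\in[0,1]^n$ such that $f(x_i)=\sigma_i$ for all $i$, for some $f\in\mathsf{thr}(\mathcal K)$, is universally measurable. Let $\mathcal L^*$ be the set of losses $\ell:[0,1]\times\{0,1\}\to\mathbb R$ that are proper, i.e. $\mathbb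 E_{y\sim\mathrm{Ber}(q)}[\ell(p,y)-\ell(q,y)]\ge0$ for all $p,q\in[0,1]$, and satisfy $|\ell(p,1)-\ell(p,0)|\le1$ for all $p$. For a distribution $J$ of $(p,y)$ let $$\mathsf{CDL}_{\mathcal K}(J)=\sup_{\ell\in\mathcal L^*,\,\kappa\in\mathcal K}\mathbb E_{J}[\ell(p,y)-\ell(\kappa(p),y)],\qquad \mathsf{ECE}(J)=\mathbb E_J\big|\mathbb E[y-p\mid p]\big|.$$ An *$(\alpha,\beta)$-tester* (respectively *$(\alpha,\beta)$-auditor*) for $\mathsf{CDL}_{\mathcal K}$ with $m$ samples is a randomized algorithm which, for every distribution $J$, reads $m$ i.i.d. examples from $J$ and, with probability at least $2/3$ over the sample and its internal randomness, outputs Reject if $\mathsf{CDL}_{\mathcal K}(J)>\alpha$, and outputs Accept if $\mathsf{CDL}_{\mathcal K}(J)\le\beta$ (respectively if $\mathsf{ECE}(J)\le\beta/2$). The acceptance probability is a universally measurable function of the sample. There are absolute constants $C,c>0$ such that the following hold for every valid post-processing class $\mathcal K$. 1. If $d<\infty$ and $\mathsf{thr}(\mathcal K)$ is a measurable class, then for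 all $\alpha,\varepsilon\in(0,1)$ there is an $(\alpha,\alpha-\varepsilon)$-tester for $\mathsf{CDL}_{\mathcal K}$ that uses at most $C\,d\log(2/\varepsilon)/\varepsilon^2$ samples. 2. Every $(1/8,0)$-auditor for $\mathsf{CDL}_{\mathcal K}$ uses at least $c\sqrt d$ samples; in particular, if $d=\infty$, no $(1/8,0)$-auditor with a finite number of samples exists. -/

import Mathlib

open MeasureTheory
open scoped ENNReal

namespace CalDecisionLoss

noncomputable section

/-- Labelled examples `(p, y) ∈ [0,1] × {0,1}`; the outcome `y = 1` is `true`. -/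
abbrev Example : Type := unitInterval × Bool

/-- The outcome as a real number, `0` or `1`. -/
def outcome (y : Bool) : ℝ := if y then 1 else 0

/-- `E_{y ∼ Ber(q)} [f(y)]`. -/
def bernoulliMean (q : unitInterval) (f : Bool → ℝ) : ℝ :=
  (q : ℝ) * f true + (1 - (q : ℝ)) * f false

/-- A loss `ℓ : [0,1] × {0,1} → ℝ` is proper if predicting the true bias is optimal. -/
def IsProper (l : unitInterval → Bool → ℝ) : Prop :=
  ∀ p q : unitInterval, 0 ≤ bernoulliMean q (fun y => l p y - l q y)

/-- The class `𝓛*` of proper losses with `|ℓ(p,1) - ℓ(p,0)| ≤ 1` for all `p`. -/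
def properLosses : Set (unitInterval → Bool → ℝ) :=
  {l | IsProper l ∧ ∀ p : unitInterval, |l p true - l p false| ≤ 1}

/-- The projection `[t]_0^1` of a real number to `[0,1]`. -/
def clamp (t : ℝ) : unitInterval := Set.projIcc (0 : ℝ) 1 zero_le_one t

/-- The function `κ_{s,t}(p) = [κ([p + s]_0^1) + t]_0^1`. -/
def translatePost (s t : ℝ) (k : unitInterval → unitInterval) : unitInterval → unitInterval :=
  fun p => clamp ((k (clamp ((p : ℝ) + s)) : ℝ) + t)

/-- Valid post-processing classes: they contain the identity and are translation invariant. -/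
structure IsValidPostProcessing (K : Set (unitInterval → unitInterval)) : Prop where
  identity : (fun p => p) ∈ K
  translation : ∀ s t : ℝ, ∀ k ∈ K, translatePost s t k ∈ K

/-- The calibration decision loss
`CDL_K(J) = sup { E_J[ℓ(p,y) - ℓ(κ(p),y)] | ℓ ∈ 𝓛*, κ ∈ K }`.
(The losses in `𝓛*` are monotone in `p` and have oscillation at most `2`, so that for a class `K`
of measurable functions and a probability measure `J` all integrands are integrable and the set is
bounded; it is nonempty if `K` is.) -/
def cdl (K : Set (unitInterval → unitInterval)) (J : Measure Example) : ℝ :=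
  sSup {r : ℝ | ∃ l ∈ properLosses, ∃ k ∈ K, r = ∫ z, (l z.1 z.2 - l (k z.1) z.2) ∂J}

/-- The expected calibration error `ECE(J) = E |E[y - p | p]|`. -/
def ece (J : Measure Example) : ℝ :=
  ∫ z, |condExp (MeasurableSpace.comap (Prod.fst : Example → unitInterval) inferInstance) J
    (fun w : Example => outcome w.2 - (w.1 : ℝ)) z| ∂J

/-- `sign₊(t)`, which is `+1` if `t ≥ 0` and `-1` if `t < 0`; the type `ℤˣ` is `{1, -1}`. -/
def signPlus (t : ℝ) : ℤˣ := if 0 ≤ t then 1 else -1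

/-- The upper thresholds `thr(K) = {p ↦ sign₊(κ(p) - 1/2) | κ ∈ K}`. -/
def thr (K : Set (unitInterval → unitInterval)) : Set (unitInterval → ℤˣ) :=
  {f | ∃ k ∈ K, f = fun p => signPlus ((k p : ℝ) - 1 / 2)}

/-- `C` shatters `S`: every sign function on `S` is the restriction of a member of `C`. -/
def Shatters (C : Set (unitInterval → ℤˣ)) (S : Set unitInterval) : Prop :=
  ∀ g : S → ℤˣ, ∃ f ∈ C, ∀ x : S, f x = g x

/-- The VC dimension, `⊤` if finite sets of arbitrarily large size are shattered. -/
def vcDim (C : Set (unitInterval → ℤˣ)) : ℕ∞ :=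
  ⨆ (S : Finset unitInterval) (_ : Shatters C (S : Set unitInterval)), (S.card : ℕ∞)

/-- Universally measurable sets: measurable for the completion of every probability measure. -/
def UniversallyMeasurableSet {X : Type*} [MeasurableSpace X] (s : Set X) : Prop :=
  ∀ μ : Measure X, IsProbabilityMeasure μ → NullMeasurableSet s μ

/-- Universally measurable functions: measurable for the completion of every probability
measure. -/
def UniversallyMeasurable {X Y : Type*} [MeasurableSpace X] [MeasurableSpace Y] (f : X → Y) :
    Prop :=
  ∀ μ : Measure X, IsProbabilityMeasure μ → AEMeasurable f μ

/-- The usual regularity of a (possibly uncountable) class of sign functions in uniform laws of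
large numbers: for every sign pattern `σ` of length `n`, the set of the `n`-tuples of points on
which some member of the class realizes `σ` is universally measurable. Equivalently, all functions
`x ↦ sup_{f ∈ C} ∑ i, a i * f (x i)` are universally measurable. -/
def IsMeasurableClass (C : Set (unitInterval → ℤˣ)) : Prop :=
  ∀ (n : ℕ) (σ : Fin n → ℤˣ),
    UniversallyMeasurableSet {x : Fin n → unitInterval | ∃ f ∈ C, ∀ i, f (x i) = σ i}

/-- A randomized algorithm that reads `m` examples and outputs Accept or Reject, given by the
probability, over its internal randomness, that it accepts the sample. -/
structure RandomizedTest (m : ℕ) where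
  accept : (Fin m → Example) → unitInterval
  measurable_accept : UniversallyMeasurable accept

/-- The probability, over `m` i.i.d. examples from `J` and the internal randomness, that the
algorithm outputs Accept. -/
def RandomizedTest.probAccept {m : ℕ} (A : RandomizedTest m) (J : Measure Example) : ℝ :=
  ∫ s, (A.accept s : ℝ) ∂(Measure.pi fun _ : Fin m => J)

/-- The probability, over `m` i.i.d. examples from `J` and the internal randomness, that the
algorithm outputs Reject. -/
def RandomizedTest.probReject {m : ℕ} (A : RandomizedTest m) (J : Measure Example) : ℝ :=
  ∫ s, (1 - (A.accept s : ℝ)) ∂(Measure.pi fun _ : Fin m => J)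

/-- `A` is an `(α, β)`-tester for `CDL_K`. -/
def IsTester (K : Set (unitInterval → unitInterval)) (α β : ℝ) {m : ℕ} (A : RandomizedTest m) :
    Prop :=
  ∀ J : Measure Example, IsProbabilityMeasure J →
    (α < cdl K J → 2 / 3 ≤ A.probReject J) ∧ (cdl K J ≤ β → 2 / 3 ≤ A.probAccept J)

/-- `A` is an `(α, β)`-auditor for `CDL_K`. -/
def IsAuditor (K : Set (unitInterval → unitInterval)) (α β : ℝ) {m : ℕ} (A : RandomizedTest m) :
    Prop :=
  ∀ J : Measure Example, IsProbabilityMeasure J →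
    (α < cdl K J → 2 / 3 ≤ A.probReject J) ∧ (ece J ≤ β / 2 → 2 / 3 ≤ A.probAccept J)

end

end CalDecisionLoss

namespace CalDecisionLoss

noncomputable section

/-! ### Proper losses -/

/-! A proper loss is governed by its slope `ℓ(p,1) - ℓ(p,0)`: properness makes the slope antitone
and a supergradient of the Bayes risk, so uniformly close slopes force uniformly close loss
increments. A bounded antitone slope is nearly an average of steps, hence the increments of any loss
in `𝓛*` are nearly averages of increments of V-shaped losses (`exists_average_vLoss`). Translation
invariance of `K` turns a V-shaped loss composed with `κ` into a member of `thr K`. Thus the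
calibration decision loss is the supremum of `E[(f(p) - sign₊(p - v)) (y - v)]` over `f ∈ thr K` and
tips `v`, and rational tips suffice (`integral_gapAt_le_cdl`, `cdl_le_of_integral_gapAt_le`).

Upper bound. The tester compares the empirical version of this supremum with `α - ε/2`. The tip
enters only through the nonnegative weights `v` and `1 - v`, so it suffices to control the functions
`± f(p) 1[y = c]` uniformly over `f ∈ thr K`. A ghost sample, random swaps, Massart's exponential
moment bound and the Sauer-Shelah lemma bound the expected deviation. Since only confidence `2/3` is
required, Markov's inequality finishes the argument (`exists_uniform_deviation`).

Lower bound. A shattered set can be cut into short pieces, and a large piece translated next to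
`1/2`, where it is still shattered (`exists_shatters_near_half`). On it, calibrated labels have zero
calibration error, while every deterministic labelling has decision loss above `1/8`, because some
`f ∈ thr K` reproduces the labels. Calibrated labels are a mixture of deterministic labellings as
long as no point is sampled twice, so by the birthday bound an auditor needs on the order of `√d`
samples (`probAccept_le_of_forall_labelWeight`). -/

/-- The slope `ℓ(p,1) - ℓ(p,0)` of a loss. -/
def slope (l : unitInterval → Bool → ℝ) (p : unitInterval) : ℝ := l p true - l p false

lemma isProper_iff {l : unitInterval → Bool → ℝ} :
    IsProper l ↔ ∀ p q : unitInterval,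
      (q : ℝ) * (slope l q - slope l p) ≤ l p false - l q false := by
  refine forall₂_congr fun p q => ?_
  simp only [bernoulliMean, slope]
  constructor <;> intro h <;> nlinarith

lemma IsProper.le_sub {l : unitInterval → Bool → ℝ} (h : IsProper l) (p q : unitInterval) :
    (q : ℝ) * (slope l q - slope l p) ≤ l p false - l q false :=
  isProper_iff.1 h p q

/-- Adding the properness inequalities for `(p, q)` and `(q, p)` cancels the loss values and leaves
`(q - p)(slope q - slope p) ≤ 0`. -/
lemma IsProper.antitone_slope {l : unitInterval → Bool → ℝ} (h : IsProper l) :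
    Antitone (slope l) := by
  intro p q hpq
  have h1 := h.le_sub p q
  have h2 := h.le_sub q p
  rcases hpq.eq_or_lt with rfl | hlt
  · exact le_rfl
  · have : (p : ℝ) < q := hlt
    by_contra! hc
    nlinarith

/-- The Bayes risk `E_{y ∼ Ber(p)} ℓ(p,y)`. -/
def bayesRisk (l : unitInterval → Bool → ℝ) (p : unitInterval) : ℝ := l p false + p * slope l p

/-- Predicting `p` under the true bias `q` costs an amount affine in `q`, tangent to the Bayes risk
at `p` and, by properness, above it everywhere: the slope is a supergradient. -/
lemma IsProper.bayesRisk_sub_le {l : unitInterval → Bool → ℝ} (h : IsProper l)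
    (p q : unitInterval) : bayesRisk l q - bayesRisk l p ≤ ((q : ℝ) - p) * slope l p := by
  have := h.le_sub p q
  simp only [bayesRisk]
  nlinarith

lemma IsProper.abs_sub_le_two {l : unitInterval → Bool → ℝ} (h : l ∈ properLosses)
    (p q : unitInterval) (y : Bool) : |l p y - l q y| ≤ 2 := by
  have h1 := h.1.le_sub p q
  have h2 := h.1.le_sub q p
  have a1 := abs_le.1 (h.2 p)
  have a2 := abs_le.1 (h.2 q)
  have p0 := p.2.1
  have p1 := p.2.2
  have q0 := q.2.1
  have q1 := q.2.2
  simp only [slope] at h1 h2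
  rw [abs_le]
  cases y <;> constructor <;> nlinarith

/-- The Bayes risks of proper losses with uniformly close slopes have close increments. -/
lemma abs_bayesRisk_sub_le {l l' : unitInterval → Bool → ℝ} (hl : IsProper l) (hl' : IsProper l')
    {δ : ℝ} (hδ : ∀ p, |slope l p - slope l' p| ≤ δ) {p q : unitInterval} (hpq : p ≤ q) :
    |(bayesRisk l q - bayesRisk l' q) - (bayesRisk l p - bayesRisk l' p)| ≤ δ := by
  have hpq' : (p : ℝ) ≤ q := hpq
  have hδ0 : 0 ≤ δ := (abs_nonneg _).trans (hδ p)
  set D : unitInterval → ℝ := fun r => bayesRisk l r - bayesRisk l' r with hD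
  -- Each Bayes risk increment lies between `(b - a)` times the slope at `b` and at `a`; comparing
  -- the two losses costs `δ` plus the variation of one slope.
  have step : ∀ a b : unitInterval, a ≤ b →
      |D b - D a| ≤ ((b : ℝ) - a) * (δ + (slope l a - slope l b)) := by
    intro a b hab
    have hab' : 0 ≤ (b : ℝ) - a := sub_nonneg.2 hab
    have h1 := hl.bayesRisk_sub_le a b
    have h2 := hl.bayesRisk_sub_le b a
    have h3 := hl'.bayesRisk_sub_le a b
    have h4 := hl'.bayesRisk_sub_le b a
    have da := abs_le.1 (hδ a)
    have db := abs_le.1 (hδ b)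
    simp only [hD]
    rw [abs_le]
    constructor
    · nlinarith [mul_nonneg hab' (sub_nonneg.2 da.1), mul_nonneg hab' (sub_nonneg.2 da.2)]
    · nlinarith [mul_nonneg hab' (sub_nonneg.2 db.1), mul_nonneg hab' (sub_nonneg.2 db.2)]
  -- Over a mesh of `M + 1` equal steps the `δ` terms add up to at most `δ`, while the slope
  -- variation telescopes and carries the vanishing factor `1 / (M + 1)`. This takes the place of
  -- integrating the slope.
  have bound : ∀ M : ℕ, |D q - D p| ≤ δ + (slope l p - slope l q) * (1 / ((M : ℝ) + 1)) := by
    intro M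
    have hM : (0 : ℝ) < (M : ℝ) + 1 := by positivity
    set w : ℝ := ((q : ℝ) - p) / ((M : ℝ) + 1) with hw
    have hw0 : 0 ≤ w := div_nonneg (sub_nonneg.2 hpq') hM.le
    have hwM : ((M : ℝ) + 1) * w = q - p := by rw [hw]; field_simp
    have mem : ∀ i : ℕ, i ≤ M + 1 → (p : ℝ) + i * w ∈ Set.Icc (0 : ℝ) 1 := by
      intro i hi
      have hi' : (i : ℝ) ≤ (M : ℝ) + 1 := by exact_mod_cast hi
      have := mul_le_mul_of_nonneg_right hi' hw0
      exact ⟨add_nonneg p.2.1 (by positivity), by linarith [q.2.2]⟩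
    set x : ℕ → unitInterval := fun i => clamp ((p : ℝ) + i * w) with hx
    have xval : ∀ i : ℕ, i ≤ M + 1 → (x i : ℝ) = p + i * w := by
      intro i hi
      simp only [hx, clamp]
      rw [Set.projIcc_of_mem _ (mem i hi)]
    have x0 : x 0 = p := Subtype.ext (by simpa using xval 0 (Nat.zero_le _))
    have xM : x (M + 1) = q := Subtype.ext (by
      rw [xval _ le_rfl]; push_cast; linarith)
    have key : ∀ n : ℕ, n ≤ M + 1 →
        |D (x n) - D (x 0)| ≤ n * w * δ + w * (slope l (x 0) - slope l (x n)) := by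
      intro n
      induction n with
      | zero => intro _; simp
      | succ n ih =>
        intro hn
        have ih := ih (by omega)
        have hle : x n ≤ x (n + 1) := by
          change (x n : ℝ) ≤ x (n + 1)
          rw [xval n (by omega), xval _ hn]
          push_cast
          nlinarith
        have hs := step _ _ hle
        rw [xval n (by omega), xval _ hn] at hs
        push_cast at hs ⊢
        have tri := abs_add_le (D (x (n + 1)) - D (x n)) (D (x n) - D (x 0))
        rw [sub_add_sub_cancel] at tri
        nlinarith
    have := key (M + 1) le_rfl
    rw [x0, xM] at this
    push_cast at this
    have hs : 0 ≤ slope l p - slope l q := sub_nonneg.2 (hl.antitone_slope hpq)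
    have hw1 : w ≤ 1 / ((M : ℝ) + 1) := by
      rw [hw]
      apply div_le_div_of_nonneg_right _ hM.le
      linarith [q.2.2, p.2.1]
    have hqp : (q : ℝ) - p ≤ 1 := by linarith [q.2.2, p.2.1]
    nlinarith [mul_le_mul_of_nonneg_right hw1 hs, mul_le_mul_of_nonneg_right hqp hδ0]
  have lim := (tendsto_one_div_add_atTop_nhds_zero_nat (𝕜 := ℝ)).const_mul
    (slope l p - slope l q) |>.const_add δ
  rw [mul_zero, add_zero] at lim
  exact ge_of_tendsto' lim bound

/-- Proper losses with uniformly close slopes have close increments. -/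
lemma abs_loss_sub_le {l l' : unitInterval → Bool → ℝ} (hl : IsProper l) (hl' : IsProper l')
    {δ : ℝ} (hδ : ∀ p, |slope l p - slope l' p| ≤ δ) (p q : unitInterval) (y : Bool) :
    |(l p y - l q y) - (l' p y - l' q y)| ≤ 5 * δ := by
  have hH : |(bayesRisk l p - bayesRisk l' p) - (bayesRisk l q - bayesRisk l' q)| ≤ δ := by
    rcases le_total p q with h | h
    · rw [abs_sub_comm]
      exact abs_bayesRisk_sub_le hl hl' hδ h
    · exact abs_bayesRisk_sub_le hl hl' hδ h
  have mulbd : ∀ r : unitInterval, |(r : ℝ) * (slope l r - slope l' r)| ≤ δ := by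
    intro r
    rw [abs_mul, abs_of_nonneg r.2.1]
    have := hδ r
    nlinarith [r.2.2, r.2.1, abs_nonneg (slope l r - slope l' r)]
  have hp := abs_le.1 (hδ p)
  have hq := abs_le.1 (hδ q)
  have mp := abs_le.1 (mulbd p)
  have mq := abs_le.1 (mulbd q)
  have hH := abs_le.1 hH
  have hδ0 : 0 ≤ δ := (abs_nonneg _).trans (hδ p)
  simp only [bayesRisk] at hH
  rw [abs_le]
  -- Since `l p false = bayesRisk l p - p * slope l p`, label `false` costs `δ + 2δ`; label `true`
  -- adds one slope difference at each of `p` and `q`, hence `5δ`.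
  cases y
  · constructor <;> nlinarith
  · simp only [slope] at *
    constructor <;> nlinarith

/-! ### V-shaped losses and their averages. -/

/-- The sign of membership in a set. -/
def setSign (A : Set unitInterval) (p : unitInterval) : ℝ :=
  open Classical in if p ∈ A then 1 else -1

lemma abs_setSign (A : Set unitInterval) (p : unitInterval) : |setSign A p| = 1 := by
  unfold setSign
  split_ifs <;> simp

/-- The V-shaped loss with threshold set `A` and tip `v`. -/
def vLoss (A : Set unitInterval) (v : ℝ) (p : unitInterval) (y : Bool) : ℝ :=
  -(setSign A p * (outcome y - v))

lemma slope_vLoss (A : Set unitInterval) (v : ℝ) (p : unitInterval) :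
    slope (vLoss A v) p = -setSign A p := by
  simp [slope, vLoss, outcome]; ring

lemma isProper_vLoss {A : Set unitInterval} {v : ℝ} (h1 : ∀ p ∈ A, v ≤ p)
    (h2 : ∀ p ∉ A, (p : ℝ) ≤ v) : IsProper (vLoss A v) := by
  rw [isProper_iff]
  intro p q
  rw [slope_vLoss, slope_vLoss]
  simp only [vLoss, outcome, setSign]
  by_cases hp : p ∈ A <;> by_cases hq : q ∈ A <;> simp [hp, hq]
  · linarith [h2 q hq]
  · linarith [h1 q hq]

lemma vLoss_mem_properLosses {A : Set unitInterval} {v : ℝ} (h1 : ∀ p ∈ A, v ≤ p)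
    (h2 : ∀ p ∉ A, (p : ℝ) ≤ v) : vLoss A v ∈ properLosses :=
  ⟨isProper_vLoss h1 h2, fun p => by
    have := slope_vLoss A v p
    rw [slope] at this
    rw [this, abs_neg, abs_setSign]⟩

/-- A proper loss of slope at most `1` is close to an average of V-shaped losses. -/
lemma exists_average_vLoss {l : unitInterval → Bool → ℝ} (h : l ∈ properLosses) {N : ℕ}
    (hN : 0 < N) :
    ∃ A : ℕ → Set unitInterval, (∀ j, IsUpperSet (A j)) ∧ ∀ p q y,
      |(l p y - l q y) - (1 / (N : ℝ)) * ∑ j ∈ Finset.range N,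
        (vLoss (A j) (sInf (A j) : unitInterval) p y
          - vLoss (A j) (sInf (A j) : unitInterval) q y)| ≤ 10 / N := by
  have hN' : (0 : ℝ) < N := by exact_mod_cast hN
  -- Rescaling the slope from `[-1, 1]` to a monotone function with values in `[0, N]` allows a
  -- layer-cake decomposition: the `j`-th layer is the upper set where `⌊r⌋ > j`, and rounding down
  -- costs at most `2 / N` in slope. An empty layer has tip `sInf ∅ = 1`.
  set r : unitInterval → ℝ := fun p => N * (1 - slope l p) / 2 with hr
  have rmono : Monotone r := by
    intro p q hpq
    have := h.1.antitone_slope hpq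
    simp only [hr]
    gcongr
  have r0 : ∀ p, 0 ≤ r p := fun p => by
    have := (abs_le.1 (h.2 p)).2
    have : 0 ≤ 1 - slope l p := by rw [slope]; linarith
    simp only [hr]; positivity
  have rN : ∀ p, r p ≤ N := fun p => by
    have := (abs_le.1 (h.2 p)).1
    have : 1 - slope l p ≤ 2 := by rw [slope]; linarith
    simp only [hr]; nlinarith
  set A : ℕ → Set unitInterval := fun j => {p | j < ⌊r p⌋₊} with hA
  have upper : ∀ j, IsUpperSet (A j) := fun j p q hpq hp =>
    lt_of_lt_of_le hp (Nat.floor_mono (rmono hpq))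
  refine ⟨A, upper, ?_⟩
  set L : unitInterval → Bool → ℝ := fun p y =>
    (1 / (N : ℝ)) * ∑ j ∈ Finset.range N, vLoss (A j) (sInf (A j) : unitInterval) p y with hL
  have pr : ∀ j, IsProper (vLoss (A j) (sInf (A j) : unitInterval)) := by
    intro j
    refine isProper_vLoss (fun p hp => ?_) (fun p hp => ?_)
    · exact sInf_le hp
    · refine le_sInf (a := p) fun q hq => ?_
      by_contra! hc
      exact hp (upper j hc.le hq)
  have slopeL : ∀ p, slope L p = -(1 / (N : ℝ)) * ∑ j ∈ Finset.range N, setSign (A j) p := by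
    intro p
    simp only [slope, hL]
    rw [← mul_sub, ← Finset.sum_sub_distrib, neg_mul, ← mul_neg, ← Finset.sum_neg_distrib]
    congr 1
    exact Finset.sum_congr rfl fun j _ => slope_vLoss _ _ _
  have Lproper : IsProper L := by
    rw [isProper_iff]
    intro p q
    have : ∀ j ∈ Finset.range N, _ := fun j _ => (pr j).le_sub p q
    have := Finset.sum_le_sum this
    rw [slopeL, slopeL]
    simp only [hL, slope_vLoss] at this ⊢
    rw [← Finset.mul_sum, Finset.sum_sub_distrib, Finset.sum_sub_distrib] at this
    rw [Finset.sum_neg_distrib, Finset.sum_neg_distrib] at this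
    have h1 : (0 : ℝ) ≤ 1 / N := by positivity
    nlinarith [mul_le_mul_of_nonneg_left this h1]
  have cnt : ∀ p, ∑ j ∈ Finset.range N, setSign (A j) p = 2 * (⌊r p⌋₊ : ℝ) - N := by
    intro p
    have hk : ⌊r p⌋₊ ≤ N := Nat.floor_le_of_le (rN p)
    have : ∀ k, ∀ n, k ≤ n → ∑ j ∈ Finset.range n, (if j < k then (1 : ℝ) else -1)
        = 2 * k - n := by
      intro k n hkn
      induction n, hkn using Nat.le_induction with
      | base =>
        rw [Finset.sum_congr rfl (g := fun _ => (1 : ℝ))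
          (fun j hj => if_pos (Finset.mem_range.1 hj))]
        simp; ring
      | succ n hn ih =>
        rw [Finset.sum_range_succ, ih, if_neg (by omega)]; push_cast; ring
    rw [← this _ _ hk]
    refine Finset.sum_congr rfl fun j _ => ?_
    simp only [setSign, hA, Set.mem_ofPred_eq]
  have close : ∀ p, |slope l p - slope L p| ≤ 2 / N := by
    intro p
    have f1 := Nat.floor_le (r0 p)
    have f2 := (Nat.lt_floor_add_one (r p)).le
    have e : slope l p - slope L p = 2 / N * (⌊r p⌋₊ - r p) := by
      rw [slopeL, cnt]
      simp only [hr]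
      field_simp
      ring
    have h2 : (0 : ℝ) < 2 / N := by positivity
    rw [e, abs_mul, abs_of_pos h2]
    have : |(⌊r p⌋₊ : ℝ) - r p| ≤ 1 := by rw [abs_le]; constructor <;> linarith
    nlinarith
  intro p q y
  have := abs_loss_sub_le h.1 Lproper close p q y
  have e : L p y - L q y = (1 / (N : ℝ)) * ∑ j ∈ Finset.range N,
      (vLoss (A j) (sInf (A j) : unitInterval) p y
        - vLoss (A j) (sInf (A j) : unitInterval) q y) := by
    simp only [hL]
    rw [Finset.sum_sub_distrib, mul_sub]
  rw [e] at this
  refine this.trans (le_of_eq ?_)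
  ring

/-! ### The calibration decision loss through V-shaped losses -/

/-- A sign as a real number. -/
def signReal (u : ℤˣ) : ℝ := ((u : ℤ) : ℝ)

lemma abs_signReal (u : ℤˣ) : |signReal u| = 1 := by
  rcases Int.units_eq_one_or u with rfl | rfl <;> simp [signReal]

lemma signReal_signPlus (t : ℝ) : signReal (signPlus t) = if 0 ≤ t then 1 else -1 := by
  unfold signPlus
  split_ifs <;> simp [signReal]

/-- The loss gap between the V-shaped decisions `sign₊(p - v)` and the decisions `f(p)`. -/
def gapAt (f : unitInterval → ℤˣ) (v : ℝ) (z : Example) : ℝ :=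
  (signReal (f z.1) - signReal (signPlus ((z.1 : ℝ) - v))) * (outcome z.2 - v)

lemma measurable_outcome : Measurable outcome := measurable_of_finite _

lemma measurable_signReal : Measurable signReal :=
  (measurable_of_countable fun n : ℤ => (n : ℝ)).comp (comap_measurable Units.val)

lemma measurable_signPlus : Measurable signPlus :=
  Measurable.ite measurableSet_Ici measurable_const measurable_const

lemma outcome_mem (y : Bool) : outcome y ∈ Set.Icc (0 : ℝ) 1 := by
  cases y <;> simp [outcome]

lemma abs_outcome_sub_le {v : ℝ} (hv : v ∈ Set.Icc (0 : ℝ) 1) (y : Bool) :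
    |outcome y - v| ≤ 1 := by
  have := outcome_mem y
  rw [abs_le]
  constructor <;> linarith [this.1, this.2, hv.1, hv.2]

lemma abs_sub_mul_le {a b c : ℝ} (ha : |a| = 1) (hb : |b| = 1) (hc : |c| ≤ 1) :
    |(a - b) * c| ≤ 2 := by
  rw [abs_mul]
  have := abs_sub a b
  nlinarith [abs_nonneg (a - b), abs_nonneg c]

lemma abs_gapAt_le (f : unitInterval → ℤˣ) {v : ℝ} (hv : v ∈ Set.Icc (0 : ℝ) 1) (z : Example) :
    |gapAt f v z| ≤ 2 :=
  abs_sub_mul_le (abs_signReal _) (abs_signReal _) (abs_outcome_sub_le hv _)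

lemma integrable_of_abs_le {X : Type*} [MeasurableSpace X] {μ : Measure X} [IsFiniteMeasure μ]
    {f : X → ℝ} {C : ℝ} (hf : Measurable f) (h : ∀ x, |f x| ≤ C) : Integrable f μ :=
  Integrable.of_bound hf.aestronglyMeasurable C (Filter.Eventually.of_forall h)

lemma translatePost_zero_left (t : ℝ) (k : unitInterval → unitInterval) (p : unitInterval) :
    translatePost 0 t k p = clamp ((k p : ℝ) + t) := by
  simp [translatePost, clamp, Set.projIcc_val]

/-- Truncation to `[0,1]` is invisible to thresholds in `(0, 1]`; at `a = 0` the equivalence fails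
for negative `t`. -/
lemma le_clamp_iff {a t : ℝ} (h0 : 0 < a) (h1 : a ≤ 1) : a ≤ (clamp t : ℝ) ↔ a ≤ t := by
  simp only [clamp, Set.coe_projIcc]
  simp [h1, h0.not_ge]

/-- The output shift by `1/2 - v` moves the threshold from `v` to `1/2`. With `κ` the identity, this
puts the optimal V-shaped decisions themselves into `thr K`. -/
lemma signPlus_sub_mem_thr {K : Set (unitInterval → unitInterval)} (hK : IsValidPostProcessing K)
    {k : unitInterval → unitInterval} (hk : k ∈ K) (v : ℝ) :
    (fun p => signPlus ((k p : ℝ) - v)) ∈ thr K := by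
  refine ⟨_, hK.translation 0 (1 / 2 - v) k hk, ?_⟩
  funext p
  rw [translatePost_zero_left]
  simp only [signPlus, sub_nonneg]
  simp only [le_clamp_iff (a := 1 / 2) (by norm_num) (by norm_num)]
  congr 1
  simp only [eq_iff_iff]
  constructor <;> intro h <;> linarith

lemma measurable_of_mem_thr {K : Set (unitInterval → unitInterval)}
    (hm : ∀ k ∈ K, Measurable k) {f : unitInterval → ℤˣ} (hf : f ∈ thr K) : Measurable f := by
  obtain ⟨k, hk, rfl⟩ := hf
  exact measurable_signPlus.comp (((hm k hk).subtype_val).sub_const _)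

lemma measurable_gapAt {f : unitInterval → ℤˣ} (hf : Measurable f) (v : ℝ) :
    Measurable (gapAt f v) :=
  ((measurable_signReal.comp (hf.comp measurable_fst)).sub
    (measurable_signReal.comp (measurable_signPlus.comp
      (measurable_fst.subtype_val.sub_const _)))).mul
    ((measurable_outcome.comp measurable_snd).sub_const _)

lemma bddAbove_cdl (K : Set (unitInterval → unitInterval)) (J : Measure Example)
    [IsProbabilityMeasure J] :
    BddAbove {r : ℝ | ∃ l ∈ properLosses, ∃ k ∈ K,
      r = ∫ z, (l z.1 z.2 - l (k z.1) z.2) ∂J} := by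
  refine ⟨2, ?_⟩
  rintro r ⟨l, hl, k, -, rfl⟩
  have := norm_integral_le_of_norm_le_const (μ := J) (C := 2)
    (f := fun z : Example => l z.1 z.2 - l (k z.1) z.2)
    (Filter.Eventually.of_forall fun z => IsProper.abs_sub_le_two hl _ _ _)
  simp only [Real.norm_eq_abs, probReal_univ, mul_one] at this
  exact (abs_le.1 this).2

/-- The V-shaped losses bound the calibration decision loss from below. -/
lemma integral_gapAt_le_cdl {K : Set (unitInterval → unitInterval)}
    (hK : IsValidPostProcessing K) (J : Measure Example) [IsProbabilityMeasure J]
    {f : unitInterval → ℤˣ} (hf : f ∈ thr K) {v : ℝ} (hv : v ∈ Set.Icc (0 : ℝ) 1) :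
    ∫ z, gapAt f v z ∂J ≤ cdl K J := by
  obtain ⟨k, hk, rfl⟩ := hf
  set A : Set unitInterval := {p | v ≤ p} with hA
  have hl : vLoss A v ∈ properLosses :=
    vLoss_mem_properLosses (fun p hp => hp) fun p hp => (not_le.1 hp).le
  -- The shift makes the new post-processing reach `v` exactly when `k` reaches `1/2`, provided `v >
  -- 0`.
  have hk' := hK.translation 0 (v - 1 / 2) k hk
  refine le_trans ?_ (le_csSup (bddAbove_cdl K J) ⟨_, hl, _, hk', rfl⟩)
  have hsA : ∀ p : unitInterval, setSign A p = signReal (signPlus ((p : ℝ) - v)) := by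
    intro p
    simp only [setSign, signReal_signPlus, sub_nonneg, hA, Set.mem_ofPred_eq]
  -- At `v = 0` the truncated value always reaches the threshold, so the correspondence breaks. Then
  -- the left side is nonpositive, and the loss itself contributes `0` to the supremum.
  by_cases h0 : v = 0
  · subst h0
    have hz : ∀ z : Example, vLoss A 0 z.1 z.2
        - vLoss A 0 (translatePost 0 (0 - 1 / 2) k z.1) z.2 = 0 := by
      intro z
      have hs : ∀ p : unitInterval, setSign A p = 1 := fun p => if_pos p.2.1
      simp [vLoss, hs]
    simp only [hz, integral_zero]
    refine integral_nonpos fun z => ?_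
    have hy := (outcome_mem z.2).1
    have hp : (0 : ℝ) ≤ z.1 := z.1.2.1
    simp only [gapAt, signReal_signPlus, sub_zero, if_pos hp, Pi.zero_apply]
    split_ifs <;> linarith
  · have h0' : 0 < v := lt_of_le_of_ne hv.1 (Ne.symm h0)
    refine le_of_eq (integral_congr_ae (Filter.Eventually.of_forall fun z => ?_))
    simp only [translatePost_zero_left]
    simp only [gapAt, vLoss, hsA, signReal_signPlus, sub_nonneg]
    simp only [le_clamp_iff h0' hv.2]
    have : v ≤ (k z.1 : ℝ) + (v - 1 / 2) ↔ 1 / 2 ≤ (k z.1 : ℝ) := by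
      constructor <;> intro h <;> linarith
    simp only [this]
    ring

/-- Every nonempty upper set is a limit of upper rays with rational end points. -/
lemma exists_rat_seq_of_isUpperSet {A : Set unitInterval} (hA : IsUpperSet A) (hne : A.Nonempty) :
    ∃ q : ℕ → ℚ, (∀ n, (q n : ℝ) ∈ Set.Icc (0 : ℝ) 1) ∧
      Filter.Tendsto (fun n => (q n : ℝ)) Filter.atTop (nhds ((sInf A : unitInterval) : ℝ)) ∧
      ∀ p : unitInterval, ∀ᶠ n in Filter.atTop, ((q n : ℝ) ≤ p ↔ p ∈ A) := by
  set v : unitInterval := sInf A with hv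
  have lt_mem : ∀ p : unitInterval, v < p → p ∈ A := by
    intro p hp
    obtain ⟨a, ha, hap⟩ := sInf_lt_iff.1 hp
    exact hA hap.le ha
  have mem_le : ∀ p ∈ A, v ≤ p := fun p hp => sInf_le hp
  -- A closed ray is approximated by rational tips from below (constantly `0` when `v = 0`), an open
  -- ray from above, so that membership of each point is eventually decided correctly.
  by_cases hvA : v ∈ A
  · rcases v.2.1.eq_or_lt with h0 | h0
    · refine ⟨fun _ => 0, by simp, by simp [← h0], fun p => Filter.Eventually.of_forall fun _ => ?_⟩
      have : v ≤ p := by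
        change (v : ℝ) ≤ p
        rw [← h0]; exact p.2.1
      simp only [Rat.cast_zero, p.2.1, true_iff]
      exact hA this hvA
    · obtain ⟨u, -, hu, hlim⟩ := (Rat.denseRange_cast (𝕜 := ℝ)).exists_seq_strictMono_tendsto_of_lt
        Rat.cast_strictMono.monotone h0
      refine ⟨u, fun n => ⟨(hu n).1.le, (hu n).2.le.trans v.2.2⟩, hlim, fun p => ?_⟩
      by_cases hp : p ∈ A
      · refine Filter.Eventually.of_forall fun n => ?_
        simp only [hp, iff_true]
        exact (hu n).2.le.trans (mem_le p hp)
      · have hpv : (p : ℝ) < v := by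
          by_contra! hc
          exact hp (hA hc hvA)
        filter_upwards [hlim.eventually_const_lt hpv] with n hn
        simp only [hp, iff_false, not_le]
        exact hn
  · have h1 : (v : ℝ) < 1 := by
      obtain ⟨a, ha⟩ := hne
      have : v < a := lt_of_le_of_ne (mem_le a ha) fun h => hvA (h ▸ ha)
      exact lt_of_lt_of_le (Subtype.coe_lt_coe.2 this) a.2.2
    obtain ⟨u, -, hu, hlim⟩ := (Rat.denseRange_cast (𝕜 := ℝ)).exists_seq_strictAnti_tendsto_of_lt
      Rat.cast_strictMono.monotone h1
    refine ⟨u, fun n => ⟨v.2.1.trans (hu n).1.le, (hu n).2.le⟩, hlim, fun p => ?_⟩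
    by_cases hp : p ∈ A
    · have hpv : (v : ℝ) < p :=
        Subtype.coe_lt_coe.2 (lt_of_le_of_ne (mem_le p hp) fun h => hvA (h ▸ hp))
      filter_upwards [hlim.eventually_lt_const hpv] with n hn
      simp only [hp, iff_true]
      exact hn.le
    · refine Filter.Eventually.of_forall fun n => ?_
      simp only [hp, iff_false, not_le]
      have : p ≤ v := not_lt.1 fun h => hp (lt_mem p h)
      exact lt_of_le_of_lt (Subtype.coe_le_coe.2 this) (hu n).1

lemma measurable_setSign {A : Set unitInterval} (hA : IsUpperSet A) : Measurable (setSign A) := by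
  classical
  have : MeasurableSet A := hA.ordConnected.measurableSet
  unfold setSign
  exact Measurable.ite this measurable_const measurable_const

/-- V-shaped losses with rational tips bound the calibration decision loss from above. -/
lemma cdl_le_of_integral_gapAt_le {K : Set (unitInterval → unitInterval)}
    (hK : IsValidPostProcessing K) (hm : ∀ k ∈ K, Measurable k) (J : Measure Example)
    [IsProbabilityMeasure J] {B : ℝ}
    (hB : ∀ f ∈ thr K, ∀ q : ℚ, (q : ℝ) ∈ Set.Icc (0 : ℝ) 1 → ∫ z, gapAt f q z ∂J ≤ B) :
    cdl K J ≤ B := by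
  have hB0 : 0 ≤ B := by
    have := hB _ (signPlus_sub_mem_thr hK hK.identity ((0 : ℚ) : ℝ)) 0 (by simp)
    simpa only [gapAt, sub_self, zero_mul, integral_zero] using this
  -- An open ray is not the set where some `sign₊(p - v)` equals `1`, so the bound for rational tips
  -- is carried to arbitrary upper sets by dominated convergence.
  have upper : ∀ A : Set unitInterval, IsUpperSet A → ∀ k ∈ K,
      ∫ z, (vLoss A (sInf A : unitInterval) z.1 z.2
        - vLoss A (sInf A : unitInterval) (k z.1) z.2) ∂J ≤ B := by
    intro A hA k hk
    rcases A.eq_empty_or_nonempty with rfl | hne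
    · simpa [vLoss, setSign] using hB0
    obtain ⟨q, hq, hlim, hev⟩ := exists_rat_seq_of_isUpperSet hA hne
    have hsg : ∀ p : unitInterval, ∀ᶠ n in Filter.atTop,
        signReal (signPlus ((p : ℝ) - q n)) = setSign A p := by
      intro p
      classical
      filter_upwards [hev p] with n hn
      rw [signReal_signPlus, setSign]
      exact if_congr (sub_nonneg.trans hn) rfl rfl
    have hT : Filter.Tendsto (fun n => ∫ z, gapAt (fun p => signPlus ((k p : ℝ) - q n)) (q n) z ∂J)
        Filter.atTop (nhds (∫ z, (vLoss A (sInf A : unitInterval) z.1 z.2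
          - vLoss A (sInf A : unitInterval) (k z.1) z.2) ∂J)) := by
      refine tendsto_integral_of_dominated_convergence (fun _ => 2) (fun n => ?_)
        (integrable_const _) (fun n => Filter.Eventually.of_forall fun z => abs_gapAt_le _ (hq n) z)
        (Filter.Eventually.of_forall fun z => ?_)
      · exact (measurable_gapAt (measurable_of_mem_thr hm
          (signPlus_sub_mem_thr hK hk _)) _).aestronglyMeasurable
      · have e : vLoss A (sInf A : unitInterval) z.1 z.2
            - vLoss A (sInf A : unitInterval) (k z.1) z.2
            = (setSign A (k z.1) - setSign A z.1) * (outcome z.2 - (sInf A : unitInterval)) := by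
          simp only [vLoss]; ring
        rw [e]
        refine Filter.Tendsto.congr' (f₁ := fun n =>
          (setSign A (k z.1) - setSign A z.1) * (outcome z.2 - q n)) ?_
          ((hlim.const_sub _).const_mul _)
        filter_upwards [hsg z.1, hsg (k z.1)] with n h1 h2
        simp only [gapAt, h1, h2]
    exact le_of_tendsto' hT fun n => hB _ (signPlus_sub_mem_thr hK hk _) _ (hq n)
  have hne : {r : ℝ | ∃ l ∈ properLosses, ∃ k ∈ K,
      r = ∫ z, (l z.1 z.2 - l (k z.1) z.2) ∂J}.Nonempty :=
    ⟨_, vLoss Set.univ 0, vLoss_mem_properLosses (fun p _ => p.2.1) (by simp), _, hK.identity, rfl⟩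
  refine csSup_le hne ?_
  rintro r ⟨l, hl, k, hk, rfl⟩
  -- A non-integrable integrand has Bochner integral `0`, which `hB0` covers.
  by_cases hint : Integrable (fun z : Example => l z.1 z.2 - l (k z.1) z.2) J
  swap
  · rw [integral_undef hint]; exact hB0
  have bound : ∀ N : ℕ, ∫ z, (l z.1 z.2 - l (k z.1) z.2) ∂J ≤ B + 10 * (1 / ((N : ℝ) + 1)) := by
    intro N
    have hN : (0 : ℝ) < (N : ℝ) + 1 := by positivity
    obtain ⟨A, hA, hcl⟩ := exists_average_vLoss hl (Nat.succ_pos N)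
    have hi : ∀ j, Integrable (fun z : Example => vLoss (A j) (sInf (A j) : unitInterval) z.1 z.2
        - vLoss (A j) (sInf (A j) : unitInterval) (k z.1) z.2) J := by
      intro j
      have e : (fun z : Example => vLoss (A j) (sInf (A j) : unitInterval) z.1 z.2
        - vLoss (A j) (sInf (A j) : unitInterval) (k z.1) z.2) = fun z =>
          (setSign (A j) (k z.1) - setSign (A j) z.1)
            * (outcome z.2 - (sInf (A j) : unitInterval)) := by
        funext z
        simp only [vLoss]; ring
      rw [e]
      refine integrable_of_abs_le (C := 2) ?_ fun z =>
        abs_sub_mul_le (abs_setSign _ _) (abs_setSign _ _)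
          (abs_outcome_sub_le (Subtype.property _) _)
      exact (((measurable_setSign (hA j)).comp ((hm k hk).comp measurable_fst)).sub
        ((measurable_setSign (hA j)).comp measurable_fst)).mul
        ((measurable_outcome.comp measurable_snd).sub_const _)
    have hsum := (integrable_finsetSum (Finset.range (N + 1)) fun j _ => hi j).const_mul
      (1 / ((N + 1 : ℕ) : ℝ))
    have h1 : ∫ z, (l z.1 z.2 - l (k z.1) z.2) ∂J ≤
        ∫ z, ((1 / ((N + 1 : ℕ) : ℝ)) * ∑ j ∈ Finset.range (N + 1),
          (vLoss (A j) (sInf (A j) : unitInterval) z.1 z.2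
            - vLoss (A j) (sInf (A j) : unitInterval) (k z.1) z.2)
              + 10 / ((N + 1 : ℕ) : ℝ)) ∂J := by
      refine integral_mono hint (hsum.add (integrable_const _)) fun z => ?_
      have := (abs_le.1 (hcl z.1 (k z.1) z.2)).2
      simp only [Nat.succ_eq_add_one] at this
      dsimp only
      linarith
    refine h1.trans ?_
    rw [integral_add hsum (integrable_const _), integral_const_mul,
      integral_finsetSum _ fun j _ => hi j, integral_const]
    have h2 := Finset.sum_le_sum fun j (_ : j ∈ Finset.range (N + 1)) => upper (A j) (hA j) k hk
    simp only [Finset.sum_const, Finset.card_range, nsmul_eq_mul] at h2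
    simp only [probReal_univ, one_smul]
    push_cast at h2 ⊢
    have h3 := mul_le_mul_of_nonneg_left h2 (one_div_pos.2 hN).le
    have h4 : 1 / ((N : ℝ) + 1) * (((N : ℝ) + 1) * B) = B := by field_simp
    rw [h4] at h3
    have h5 : 10 / ((N : ℝ) + 1) = 10 * (1 / ((N : ℝ) + 1)) := by ring
    rw [h5]
    linarith
  have lim := (tendsto_one_div_add_atTop_nhds_zero_nat (𝕜 := ℝ)).const_mul 10 |>.const_add B
  rw [mul_zero, add_zero] at lim
  exact ge_of_tendsto' lim bound

/-! ### Massart's lemma and the Sauer-Shelah bound -/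

/-- The sign `-1` for `true` (swap) and `1` for `false`. -/
def swapSign (b : Bool) : ℝ := if b then -1 else 1

/-- The exponential of a sum over independent signs factorizes into terms `2 cosh (a i)`, and `cosh
t ≤ exp (t² / 2)`. -/
lemma sum_exp_swapSign_le {n : ℕ} {C : ℝ} (a : Fin n → ℝ) (ha : ∀ i, |a i| ≤ C) :
    ∑ τ : Fin n → Bool, Real.exp (∑ i, swapSign (τ i) * a i)
      ≤ 2 ^ n * Real.exp (n * (C ^ 2 / 2)) := by
  have e : ∑ τ : Fin n → Bool, Real.exp (∑ i, swapSign (τ i) * a i)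
      = ∏ i, ∑ b : Bool, Real.exp (swapSign b * a i) := by
    rw [Finset.prod_univ_sum]
    simp only [Fintype.piFinset_univ, Real.exp_sum]
  rw [e, Real.exp_nat_mul, ← mul_pow]
  calc ∏ i, ∑ b : Bool, Real.exp (swapSign b * a i)
      ≤ ∏ _i : Fin n, 2 * Real.exp (C ^ 2 / 2) := by
        refine Finset.prod_le_prod (fun i _ => Finset.sum_nonneg fun b _ => (Real.exp_pos _).le)
          fun i _ => ?_
        have h1 := Real.cosh_le_exp_half_sq (a i)
        have h2 : Real.exp (a i ^ 2 / 2) ≤ Real.exp (C ^ 2 / 2) := by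
          apply Real.exp_le_exp.2
          have := sq_le_sq' (by linarith [neg_abs_le (a i), ha i]) ((le_abs_self _).trans (ha i))
          linarith
        rw [Real.cosh_eq] at h1
        simp only [Fintype.sum_bool, swapSign, if_true, Bool.false_eq_true, if_false, neg_mul,
          one_mul]
        linarith
    _ = _ := by simp

/-- Jensen's inequality for the logarithm, in the form of its tangent line at the bound `c` for the
mean over `τ`. The extra `1` keeps the logarithm nonnegative, also for empty `V`. -/
lemma sum_log_one_add_sum_exp_le {n : ℕ} {C r : ℝ} (V : Finset (Fin n → ℝ))
    (hV : ∀ a ∈ V, ∀ i, |a i| ≤ C) :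
    ∑ τ : Fin n → Bool, Real.log (1 + ∑ a ∈ V, Real.exp (r * ∑ i, swapSign (τ i) * a i))
      ≤ 2 ^ n * (Real.log (1 + V.card) + n * ((|r| * C) ^ 2 / 2)) := by
  set E := Real.exp (n * ((|r| * C) ^ 2 / 2)) with hE
  have hE1 : 1 ≤ E := Real.one_le_exp (by positivity)
  set c := (1 + (V.card : ℝ)) * E with hc
  have hcard : (0 : ℝ) < 1 + V.card := by positivity
  have hc0 : 0 < c := by positivity
  have hlogc : Real.log c = Real.log (1 + V.card) + n * ((|r| * C) ^ 2 / 2) := by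
    rw [hc, Real.log_mul hcard.ne' (Real.exp_pos _).ne', Real.log_exp]
  rw [← hlogc]
  have h1 : ∀ τ : Fin n → Bool,
      Real.log (1 + ∑ a ∈ V, Real.exp (r * ∑ i, swapSign (τ i) * a i)) ≤
      (1 + ∑ a ∈ V, Real.exp (r * ∑ i, swapSign (τ i) * a i)) / c - 1 + Real.log c := by
    intro τ
    have hs : 0 < 1 + ∑ a ∈ V, Real.exp (r * ∑ i, swapSign (τ i) * a i) :=
      add_pos_of_pos_of_nonneg one_pos (Finset.sum_nonneg fun a _ => (Real.exp_pos _).le)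
    have := Real.log_le_sub_one_of_pos (div_pos hs hc0)
    rw [Real.log_div hs.ne' hc0.ne'] at this
    linarith
  have h2 : ∑ τ : Fin n → Bool, (1 + ∑ a ∈ V, Real.exp (r * ∑ i, swapSign (τ i) * a i))
      ≤ 2 ^ n * c := by
    rw [Finset.sum_add_distrib, Finset.sum_comm]
    have : ∀ a ∈ V, ∑ τ : Fin n → Bool, Real.exp (r * ∑ i, swapSign (τ i) * a i) ≤ 2 ^ n * E := by
      intro a ha
      have := sum_exp_swapSign_le (C := |r| * C) (fun i => r * a i) fun i => by
        rw [abs_mul]; exact mul_le_mul_of_nonneg_left (hV a ha i) (abs_nonneg _)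
      convert this using 4 with τ
      rw [Finset.mul_sum]
      exact Finset.sum_congr rfl fun i _ => by ring
    have := Finset.sum_le_sum this
    simp only [Finset.sum_const, nsmul_eq_mul, Finset.card_univ, Fintype.card_pi, Fintype.card_bool,
      Finset.prod_const, Fintype.card_fin, Nat.cast_pow, Nat.cast_ofNat, mul_one] at this ⊢
    rw [hc]
    have h3 : (2 : ℝ) ^ n ≤ 2 ^ n * E := le_mul_of_one_le_right (by positivity) hE1
    nlinarith
  refine (Finset.sum_le_sum fun τ _ => h1 τ).trans ?_
  rw [Finset.sum_add_distrib, Finset.sum_sub_distrib, ← Finset.sum_div]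
  simp only [Finset.sum_const, nsmul_eq_mul, Finset.card_univ, Fintype.card_pi, Fintype.card_bool,
      Finset.prod_const, Fintype.card_fin, Nat.cast_pow, Nat.cast_ofNat, mul_one]
  have := (div_le_iff₀ hc0).2 h2
  linarith

open Classical in
/-- The sign patterns realized by a class on a tuple of points. -/
def patterns {ι : Type*} [Fintype ι] (F : Set (unitInterval → ℤˣ)) (x : ι → unitInterval) :
    Finset (ι → ℤˣ) :=
  Finset.univ.filter fun σ => ∃ f ∈ F, ∀ i, f (x i) = σ i

lemma mem_patterns {ι : Type*} [Fintype ι] {F : Set (unitInterval → ℤˣ)} {x : ι → unitInterval}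
    {σ : ι → ℤˣ} : σ ∈ patterns F x ↔ ∃ f ∈ F, ∀ i, f (x i) = σ i := by
  simp [patterns]

/-- Multiply by `r ^ d ≤ r ^ k` and compare with the binomial expansion of `(1 + r) ^ N`. A free `r`
avoids any relation between `d` and `N`. -/
lemma sum_choose_le {N d : ℕ} {r : ℝ} (h0 : 0 < r) (h1 : r ≤ 1) :
    ∑ k ∈ Finset.Iic d, (N.choose k : ℝ) ≤ Real.exp (N * r) / r ^ d := by
  rw [le_div_iff₀ (pow_pos h0 d), Finset.sum_mul]
  have h2 : (r + 1) ^ N ≤ Real.exp (N * r) := by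
    rw [Real.exp_nat_mul]
    exact pow_le_pow_left₀ (by positivity) (Real.add_one_le_exp r) N
  refine le_trans ?_ h2
  rw [add_pow]
  simp only [one_pow, mul_one]
  calc ∑ k ∈ Finset.Iic d, (N.choose k : ℝ) * r ^ d
      ≤ ∑ k ∈ Finset.Iic d, r ^ k * (N.choose k : ℝ) := by
        refine Finset.sum_le_sum fun k hk => ?_
        rw [mul_comm]
        exact mul_le_mul_of_nonneg_right
          (pow_le_pow_of_le_one h0.le h1 (Finset.mem_Iic.1 hk)) (by positivity)
    _ ≤ ∑ k ∈ Finset.range (N + 1) ∪ Finset.Iic d, r ^ k * (N.choose k : ℝ) :=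
        Finset.sum_le_sum_of_subset_of_nonneg Finset.subset_union_right
          fun k _ _ => by positivity
    _ = ∑ k ∈ Finset.range (N + 1), r ^ k * (N.choose k : ℝ) := by
        symm
        refine Finset.sum_subset Finset.subset_union_left fun k _ hk => ?_
        rw [Nat.choose_eq_zero_of_lt (by simpa using hk)]
        simp

/-- Sauer-Shelah bound for the number of sign patterns. -/
lemma card_patterns_le {ι : Type*} [Fintype ι] {F : Set (unitInterval → ℤˣ)} {d : ℕ}
    (hd : ∀ S : Finset unitInterval, Shatters F S → S.card ≤ d) (x : ι → unitInterval) {r : ℝ}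
    (h0 : 0 < r) (h1 : r ≤ 1) :
    ((patterns F x).card : ℝ) ≤ Real.exp (Fintype.card ι * r) / r ^ d := by
  classical
  -- Patterns are read as sets of indices, so that the Sauer-Shelah lemma for finite set families
  -- applies.
  set T : (ι → ℤˣ) → Finset ι := fun σ => Finset.univ.filter fun i => σ i = 1 with hT
  have hinj : Function.Injective T := by
    intro σ σ' h
    funext i
    have := Finset.ext_iff.1 h i
    simp only [hT, Finset.mem_filter, Finset.mem_univ, true_and] at this
    rcases Int.units_eq_one_or (σ i) with h | h <;>
      rcases Int.units_eq_one_or (σ' i) with h' | h' <;> simp_all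
  set A := (patterns F x).image T with hA
  have hcard : (patterns F x).card = A.card := (Finset.card_image_of_injective _ hinj).symm
  have hvc : A.vcDim ≤ d := by
    refine Finset.sup_le fun s hs => ?_
    rw [Finset.mem_shatterer] at hs
    have hfun : ∀ t ⊆ s, ∃ f ∈ F, ∀ i ∈ s, f (x i) = 1 ↔ i ∈ t := by
      intro t ht
      obtain ⟨u, hu, hst⟩ := hs ht
      obtain ⟨σ, hσ, rfl⟩ := Finset.mem_image.1 hu
      obtain ⟨f, hf, hfσ⟩ := mem_patterns.1 hσ
      refine ⟨f, hf, fun i hi => ?_⟩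
      rw [← hst, hfσ]
      simp [hT, hi]
    -- Repeated points receive equal signs, so a shattered index set carries distinct points; its
    -- image is then shattered by `F` with the same cardinality.
    have hxinj : Set.InjOn x s := by
      intro i hi j hj hij
      obtain ⟨f, -, hf⟩ := hfun {i} (by simpa using hi)
      have h1 := (hf i hi).2 (by simp)
      rw [hij] at h1
      exact (Finset.mem_singleton.1 ((hf j hj).1 h1)).symm
    rw [← Finset.card_image_of_injOn hxinj]
    refine hd _ fun g => ?_
    obtain ⟨f, hfF, hf⟩ := hfun
      (s.filter fun i => ∃ h : x i ∈ ((s.image x : Finset unitInterval) : Set unitInterval),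
        g ⟨x i, h⟩ = 1) (Finset.filter_subset _ _)
    refine ⟨f, hfF, ?_⟩
    rintro ⟨p, hp⟩
    obtain ⟨i, hi, rfl⟩ := Finset.mem_image.1 (Finset.mem_coe.1 hp)
    have h2 := hf i hi
    simp only [Finset.mem_filter, hi, true_and] at h2
    have h3 : f (x i) = 1 ↔ g ⟨x i, hp⟩ = 1 := h2.trans ⟨fun ⟨_, h⟩ => h, fun h => ⟨hp, h⟩⟩
    change f (x i) = g ⟨x i, hp⟩
    rcases Int.units_eq_one_or (f (x i)) with h | h <;>
      rcases Int.units_eq_one_or (g ⟨x i, hp⟩) with h' | h' <;> simp_all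
  rw [hcard]
  refine le_trans ?_ (sum_choose_le h0 h1)
  have hle := (Finset.card_le_card_shatterer A).trans Finset.card_shatterer_le_sum_vcDim
  have hle2 : A.card ≤ ∑ k ∈ Finset.Iic d, (Fintype.card ι).choose k :=
    hle.trans (Finset.sum_le_sum_of_subset (Finset.Iic_subset_Iic.2 hvc))
  exact_mod_cast hle2

/-! ### The uniform law of large numbers -/

lemma UniversallyMeasurableSet.preimage {X Y : Type*} [MeasurableSpace X] [MeasurableSpace Y]
    {s : Set Y} (hs : UniversallyMeasurableSet s) {φ : X → Y} (hφ : Measurable φ) :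
    UniversallyMeasurableSet (φ ⁻¹' s) := by
  intro μ hμ
  exact (hs (μ.map φ) (Measure.isProbabilityMeasure_map hφ.aemeasurable)).preimage
    ⟨hφ, Measure.AbsolutelyContinuous.rfl⟩

lemma IsMeasurableClass.setOf_pattern {F : Set (unitInterval → ℤˣ)} (hF : IsMeasurableClass F)
    {X ι : Type*} [MeasurableSpace X] [Fintype ι] {φ : X → ι → unitInterval} (hφ : Measurable φ)
    (σ : ι → ℤˣ) : UniversallyMeasurableSet {u : X | ∃ f ∈ F, ∀ i, f (φ u i) = σ i} := by
  set e := Fintype.equivFin ι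
  have := (hF (Fintype.card ι) (σ ∘ e.symm)).preimage
    (φ := fun u : X => fun j => φ u (e.symm j))
    (measurable_pi_lambda _ fun j => (measurable_pi_apply _).comp hφ)
  convert this using 1
  ext u
  simp only [Set.mem_ofPred_eq, Set.mem_preimage, Function.comp_apply]
  refine exists_congr fun f => and_congr_right fun _ => ?_
  exact ⟨fun h j => h _, fun h i => by simpa using h (e i)⟩

/-- The value `± s · 1[y = c]`, indexed by `w = (c, ±)`. -/
def signedHit (w : Bool × ℤˣ) (s : ℤˣ) (y : Bool) : ℝ :=
  signReal w.2 * signReal s * (if y = w.1 then 1 else 0)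

lemma abs_signedHit_le (w : Bool × ℤˣ) (s : ℤˣ) (y : Bool) : |signedHit w s y| ≤ 1 := by
  rw [signedHit, abs_mul, abs_mul, abs_signReal, abs_signReal]
  split_ifs <;> simp

lemma measurable_signedHit (w : Bool × ℤˣ) (s : ℤˣ) : Measurable (signedHit w s) :=
  measurable_of_finite _

lemma measurable_signedHit_comp (w : Bool × ℤˣ) {f : unitInterval → ℤˣ} (hf : Measurable f) :
    Measurable fun z : Example => signedHit w (f z.1) z.2 :=
  ((measurable_signReal.comp (hf.comp measurable_fst)).const_mul _).mul
    ((measurable_of_finite fun y : Bool => if y = w.1 then (1 : ℝ) else 0).comp measurable_snd)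

/-! ### Symmetrization with a ghost sample. -/

/-- The difference between the means of `signedHit` over a sample and a ghost sample. -/
def ghostDiff {n : ℕ} (w : Bool × ℤˣ) (σ : Fin n ⊕ Fin n → ℤˣ) (u : Fin n → Example × Example) :
    ℝ :=
  (1 / (n : ℝ)) * ∑ i, (signedHit w (σ (.inl i)) (u i).1.2 - signedHit w (σ (.inr i)) (u i).2.2)

/-- The points of a double sample. -/
def doublePoints {n : ℕ} (u : Fin n → Example × Example) : Fin n ⊕ Fin n → unitInterval :=
  Sum.elim (fun i => (u i).1.1) (fun i => (u i).2.1)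

/-- The largest difference between the means over a sample and a ghost sample. -/
def ghostSup (F : Set (unitInterval → ℤˣ)) {n : ℕ} (u : Fin n → Example × Example) : ℝ≥0∞ :=
  ⨆ (σ : Fin n ⊕ Fin n → ℤˣ) (w : Bool × ℤˣ),
    Set.indicator {u | ∃ f ∈ F, ∀ i, f (doublePoints u i) = σ i}
      (fun u => ENNReal.ofReal (ghostDiff w σ u)) u

lemma measurable_doublePoints {n : ℕ} : Measurable (doublePoints (n := n)) := by
  refine measurable_pi_lambda _ fun i => ?_
  rcases i with i | i <;> simp only [doublePoints, Sum.elim_inl, Sum.elim_inr] <;> fun_prop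

lemma measurable_ghostDiff {n : ℕ} (w : Bool × ℤˣ) (σ : Fin n ⊕ Fin n → ℤˣ) :
    Measurable (ghostDiff w σ) := by
  refine Measurable.const_mul (Finset.measurable_sum _ fun i _ => ?_) _
  exact ((measurable_signedHit _ _).comp (by fun_prop)).sub
    ((measurable_signedHit _ _).comp (by fun_prop))

/-- Indexing by sign patterns instead of members of `F` makes the supremum finite; the
measurable-class hypothesis supplies exactly the sets on which a pattern occurs. -/
lemma universallyMeasurable_ghostSup {F : Set (unitInterval → ℤˣ)} (hF : IsMeasurableClass F)
    {n : ℕ} : UniversallyMeasurable (ghostSup F (n := n)) := by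
  intro μ hμ
  refine AEMeasurable.iSup fun σ => AEMeasurable.iSup fun w => ?_
  exact (measurable_ghostDiff w σ).ennreal_ofReal.aemeasurable.indicator₀
    (hF.setOf_pattern measurable_doublePoints σ μ hμ)

lemma ofReal_ghostDiff_le_ghostSup {F : Set (unitInterval → ℤˣ)} {f : unitInterval → ℤˣ}
    (hf : f ∈ F) {n : ℕ} (w : Bool × ℤˣ) (u : Fin n → Example × Example) :
    ENNReal.ofReal (ghostDiff w (fun i => f (doublePoints u i)) u) ≤ ghostSup F u := by
  refine le_iSup₂_of_le (fun i => f (doublePoints u i)) w ?_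
  rw [Set.indicator_of_mem]
  exact ⟨f, hf, fun _ => rfl⟩

/-- Exchange of the sample and the ghost sample in the coordinates selected by `τ`. -/
def swapAt {n : ℕ} (τ : Fin n → Bool) (u : Fin n → Example × Example) : Fin n → Example × Example :=
  fun i => if τ i then (u i).swap else u i

lemma measurePreserving_swapAt {n : ℕ} (τ : Fin n → Bool) (J : Measure Example)
    [IsProbabilityMeasure J] :
    MeasurePreserving (swapAt τ) (Measure.pi fun _ : Fin n => J.prod J)
      (Measure.pi fun _ : Fin n => J.prod J) := by
  refine measurePreserving_pi (f := fun i (z : Example × Example) => if τ i then z.swap else z) _ _ fun i => ?_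
  by_cases h : τ i
  · simp only [h, if_true]
    exact Measure.measurePreserving_swap
  · simp only [h]
    exact MeasurePreserving.id _

/-- Swapping coordinate `i` flips the sign of the `i`-th difference, so one set `V` serves all `τ`.
The maximum is then replaced by the soft maximum `log (1 + ∑ exp)`. -/
lemma ghostSup_swapAt_le {F : Set (unitInterval → ℤˣ)} {n : ℕ} (hn : 0 < n)
    (u : Fin n → Example × Example) (V : Finset (Fin n → ℝ))
    (hV : ∀ f ∈ F, ∀ w, (fun i => signedHit w (f (u i).1.1) (u i).1.2
      - signedHit w (f (u i).2.1) (u i).2.2) ∈ V) {r : ℝ} (hr : 0 < r) (τ : Fin n → Bool) :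
    ghostSup F (swapAt τ u) ≤ ENNReal.ofReal ((1 / (r * n)) *
      Real.log (1 + ∑ a ∈ V, Real.exp (r * ∑ i, swapSign (τ i) * a i))) := by
  have hn' : (0 : ℝ) < n := by exact_mod_cast hn
  refine iSup₂_le fun σ w => Set.indicator_apply_le' ?_ fun _ => zero_le
  rintro ⟨f, hf, hσ⟩
  refine ENNReal.ofReal_le_ofReal ?_
  set a : Fin n → ℝ := fun i => signedHit w (f (u i).1.1) (u i).1.2
      - signedHit w (f (u i).2.1) (u i).2.2 with ha
  have e : ghostDiff w σ (swapAt τ u) = (1 / (n : ℝ)) * ∑ i, swapSign (τ i) * a i := by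
    rw [ghostDiff]
    congr 1
    refine Finset.sum_congr rfl fun i _ => ?_
    rw [← hσ, ← hσ]
    simp only [doublePoints, Sum.elim_inl, Sum.elim_inr, swapAt, swapSign, ha]
    by_cases h : τ i <;> simp [h]
  rw [e]
  have h1 : r * ∑ i, swapSign (τ i) * a i ≤
      Real.log (1 + ∑ a ∈ V, Real.exp (r * ∑ i, swapSign (τ i) * a i)) := by
    rw [Real.le_log_iff_exp_le (add_pos_of_pos_of_nonneg one_pos
      (Finset.sum_nonneg fun a _ => (Real.exp_pos _).le))]
    have := Finset.single_le_sum (f := fun a : Fin n → ℝ =>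
      Real.exp (r * ∑ i, swapSign (τ i) * a i)) (fun a _ => (Real.exp_pos _).le) (hV f hf w)
    linarith
  calc (1 / (n : ℝ)) * ∑ i, swapSign (τ i) * a i
      = (1 / (r * n)) * (r * ∑ i, swapSign (τ i) * a i) := by field_simp
    _ ≤ _ := mul_le_mul_of_nonneg_left h1 (by positivity)

/-- The bound for the expected uniform deviation; `x` and `r` are free parameters. -/
def deviationBound (n d : ℕ) (x r : ℝ) : ℝ :=
  (2 + 2 * n * x + d * Real.log (1 / x)) / (r * n) + 2 * r

lemma sum_ghostSup_swapAt_le {F : Set (unitInterval → ℤˣ)} {d n : ℕ} (hn : 0 < n)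
    (hd : ∀ S : Finset unitInterval, Shatters F S → S.card ≤ d)
    (u : Fin n → Example × Example) {x r : ℝ} (h0 : 0 < x) (h1 : x ≤ 1) (hr : 0 < r) :
    ∑ τ : Fin n → Bool, ghostSup F (swapAt τ u) ≤
      ENNReal.ofReal (2 ^ n * deviationBound n d x r) := by
  classical
  have hn' : (0 : ℝ) < n := by exact_mod_cast hn
  set V : Finset (Fin n → ℝ) := ((patterns F (doublePoints u)) ×ˢ
    (Finset.univ : Finset (Bool × ℤˣ))).image fun ρ i =>
      signedHit ρ.2 (ρ.1 (.inl i)) (u i).1.2 - signedHit ρ.2 (ρ.1 (.inr i)) (u i).2.2 with hVdef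
  have hVmem : ∀ f ∈ F, ∀ w, (fun i => signedHit w (f (u i).1.1) (u i).1.2
      - signedHit w (f (u i).2.1) (u i).2.2) ∈ V := by
    intro f hf w
    refine Finset.mem_image.2 ⟨(fun i => f (doublePoints u i), w), ?_, rfl⟩
    exact Finset.mem_product.2 ⟨mem_patterns.2 ⟨f, hf, fun _ => rfl⟩, Finset.mem_univ _⟩
  have hVabs : ∀ a ∈ V, ∀ i, |a i| ≤ 2 := by
    intro a ha i
    obtain ⟨ρ, -, rfl⟩ := Finset.mem_image.1 ha
    refine (abs_sub _ _).trans ?_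
    linarith [abs_signedHit_le ρ.2 (ρ.1 (.inl i)) (u i).1.2,
      abs_signedHit_le ρ.2 (ρ.1 (.inr i)) (u i).2.2]
  have hVcard : (V.card : ℝ) ≤ 4 * (Real.exp (2 * n * x) / x ^ d) := by
    have c1 : V.card ≤ (patterns F (doublePoints u)).card * 4 := by
      refine Finset.card_image_le.trans ?_
      rw [Finset.card_product]
      simp
    have c2 := card_patterns_le hd (doublePoints u) h0 h1
    simp only [Fintype.card_sum, Fintype.card_fin, Nat.cast_add] at c2
    have c3 : (V.card : ℝ) ≤ (patterns F (doublePoints u)).card * 4 := by exact_mod_cast c1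
    rw [show (2 : ℝ) * n * x = (n + n) * x by ring]
    linarith
  have hlog : Real.log (1 + V.card) ≤ 2 + 2 * n * x + d * Real.log (1 / x) := by
    have hP : 1 ≤ Real.exp (2 * n * x) / x ^ d := by
      rw [one_le_div (by positivity)]
      exact (pow_le_one₀ h0.le h1).trans (Real.one_le_exp (by positivity))
    -- With four signed hits per pattern, `1 + |V| ≤ 5 * P` for the pattern bound `P ≥ 1`; this is
    -- the summand `2` of `deviationBound`.
    have he : (5 : ℝ) ≤ Real.exp 2 := by
      have := Real.exp_one_gt_d9
      rw [show (2 : ℝ) = 1 + 1 by norm_num, Real.exp_add]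
      nlinarith
    have : Real.log (1 + V.card) ≤ Real.log (Real.exp 2 * (Real.exp (2 * n * x) / x ^ d)) := by
      apply Real.log_le_log (by positivity)
      nlinarith
    refine this.trans (le_of_eq ?_)
    rw [Real.log_mul (Real.exp_pos _).ne' (by positivity), Real.log_div (Real.exp_pos _).ne'
      (by positivity), Real.log_exp, Real.log_exp, Real.log_pow, one_div, Real.log_inv]
    ring
  refine (Finset.sum_le_sum fun τ _ => ghostSup_swapAt_le hn u V hVmem hr τ).trans ?_
  rw [← ENNReal.ofReal_sum_of_nonneg]
  swap
  · intro τ _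
    refine mul_nonneg (by positivity) (Real.log_nonneg ?_)
    have := Finset.sum_nonneg (s := V) fun a _ =>
      (Real.exp_pos (r * ∑ i, swapSign (τ i) * a i)).le
    linarith
  refine ENNReal.ofReal_le_ofReal ?_
  rw [← Finset.mul_sum]
  have h2 := sum_log_one_add_sum_exp_le (r := r) V hVabs
  rw [abs_of_pos hr] at h2
  calc _ ≤ (1 / (r * n)) * (2 ^ n * (2 + 2 * n * x + d * Real.log (1 / x)
          + n * ((r * 2) ^ 2 / 2))) := by
        refine mul_le_mul_of_nonneg_left (h2.trans ?_) (by positivity)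
        gcongr
    _ = _ := by rw [deviationBound]; field_simp

/-- Each swap preserves the product measure, so the integral equals that of the average over all `2
^ n` swaps, which is bounded pointwise. -/
lemma lintegral_ghostSup_le {F : Set (unitInterval → ℤˣ)} (hF : IsMeasurableClass F) {d n : ℕ}
    (hn : 0 < n) (hd : ∀ S : Finset unitInterval, Shatters F S → S.card ≤ d) (J : Measure Example)
    [IsProbabilityMeasure J] {x r : ℝ} (h0 : 0 < x) (h1 : x ≤ 1) (hr : 0 < r) :
    ∫⁻ u, ghostSup F u ∂(Measure.pi fun _ : Fin n => J.prod J) ≤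
      ENNReal.ofReal (deviationBound n d x r) := by
  set μ := Measure.pi fun _ : Fin n => J.prod J with hμ
  have hG : AEMeasurable (ghostSup F (n := n)) μ := universallyMeasurable_ghostSup hF μ inferInstance
  have hswap : ∀ τ : Fin n → Bool, ∫⁻ u, ghostSup F (swapAt τ u) ∂μ = ∫⁻ u, ghostSup F u ∂μ := by
    intro τ
    have hp := measurePreserving_swapAt τ J
    rw [← lintegral_map' (μ := μ) (g := swapAt τ) (by rw [hp.map_eq]; exact hG)
      hp.measurable.aemeasurable, hp.map_eq]
  have hmeas : ∀ τ : Fin n → Bool, AEMeasurable (fun u => ghostSup F (swapAt τ u)) μ := fun τ =>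
    hG.comp_quasiMeasurePreserving (measurePreserving_swapAt τ J).quasiMeasurePreserving
  have h2 : (2 : ℝ≥0∞) ^ n * ∫⁻ u, ghostSup F u ∂μ ≤
      2 ^ n * ENNReal.ofReal (deviationBound n d x r) := by
    calc (2 : ℝ≥0∞) ^ n * ∫⁻ u, ghostSup F u ∂μ
        = ∑ τ : Fin n → Bool, ∫⁻ u, ghostSup F (swapAt τ u) ∂μ := by
          simp [hswap]
      _ = ∫⁻ u, ∑ τ : Fin n → Bool, ghostSup F (swapAt τ u) ∂μ :=
          (lintegral_finsetSum' _ fun τ _ => hmeas τ).symm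
      _ ≤ ∫⁻ _, ENNReal.ofReal (2 ^ n * deviationBound n d x r) ∂μ :=
          lintegral_mono fun u => sum_ghostSup_swapAt_le hn hd u h0 h1 hr
      _ = 2 ^ n * ENNReal.ofReal (deviationBound n d x r) := by
          rw [lintegral_const, measure_univ, mul_one, ENNReal.ofReal_mul (by positivity),
            ENNReal.ofReal_pow (by norm_num)]
          norm_num
  exact (ENNReal.mul_le_mul_iff_right (by simp) (by simp)).1 h2

lemma ofReal_integral_le_lintegral {X : Type*} [MeasurableSpace X] {μ : Measure X} {f : X → ℝ}
    (hf : Integrable f μ) : ENNReal.ofReal (∫ x, f x ∂μ) ≤ ∫⁻ x, ENNReal.ofReal (f x) ∂μ := by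
  have h1 : ∫ x, f x ∂μ ≤ ∫ x, max (f x) 0 ∂μ :=
    integral_mono hf hf.pos_part fun x => le_max_left _ _
  refine (ENNReal.ofReal_le_ofReal h1).trans ?_
  rw [ofReal_integral_eq_lintegral_ofReal hf.pos_part
    (Filter.Eventually.of_forall fun x => le_max_right _ _)]
  refine lintegral_mono fun x => ?_
  simp [ENNReal.ofReal_max]

/-- The mean of `g` over a sample. -/
def sampleMean {n : ℕ} (g : Example → ℝ) (s : Fin n → Example) : ℝ := (1 / (n : ℝ)) * ∑ i, g (s i)

lemma integral_sampleMean {n : ℕ} (hn : 0 < n) (J : Measure Example) [IsProbabilityMeasure J]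
    {g : Example → ℝ} (hg : Integrable g J) :
    Integrable (sampleMean (n := n) g) (Measure.pi fun _ : Fin n => J) ∧
      ∫ s, sampleMean g s ∂(Measure.pi fun _ : Fin n => J) = ∫ z, g z ∂J := by
  have hn' : (n : ℝ) ≠ 0 := by exact_mod_cast hn.ne'
  have hi : ∀ i : Fin n, Integrable (fun s : Fin n → Example => g (s i))
      (Measure.pi fun _ : Fin n => J) := fun i =>
    (measurePreserving_eval (fun _ : Fin n => J) i).integrable_comp_of_integrable hg
  refine ⟨(integrable_finsetSum _ fun i _ => hi i).const_mul _, ?_⟩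
  simp only [sampleMean]
  rw [integral_const_mul, integral_finsetSum _ fun i _ => hi i]
  have : ∀ i : Fin n, ∫ s, g (s i) ∂(Measure.pi fun _ : Fin n => J) = ∫ z, g z ∂J := fun i =>
    integral_comp_eval (μ := fun _ : Fin n => J) (f := g) hg.aestronglyMeasurable
  simp only [this, Finset.sum_const, Finset.card_univ, Fintype.card_fin, nsmul_eq_mul]
  field_simp

/-- The uniform law of large numbers: outside an event of small probability, all sample means of
signed hits are close to their expectations. -/
theorem exists_uniform_deviation {F : Set (unitInterval → ℤˣ)} (hF : IsMeasurableClass F)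
    (hm : ∀ f ∈ F, Measurable f) {d n : ℕ} (hn : 0 < n)
    (hd : ∀ S : Finset unitInterval, Shatters F S → S.card ≤ d) (J : Measure Example)
    [IsProbabilityMeasure J] {x r t : ℝ} (h0 : 0 < x) (h1 : x ≤ 1) (hr : 0 < r) (ht : 0 < t)
    (hB : 3 * deviationBound n d x r ≤ t) :
    ∃ E : Set (Fin n → Example), NullMeasurableSet E (Measure.pi fun _ : Fin n => J) ∧
      2 / 3 ≤ (Measure.pi fun _ : Fin n => J).real E ∧
      ∀ s ∈ E, ∀ f ∈ F, ∀ w,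
        sampleMean (fun z => signedHit w (f z.1) z.2) s
          - ∫ z, signedHit w (f z.1) z.2 ∂J ≤ t := by
  set μ := Measure.pi fun _ : Fin n => J with hμ
  set e := MeasurableEquiv.arrowProdEquivProdArrow Example Example (Fin n) with he
  have hp : MeasurePreserving e (Measure.pi fun _ : Fin n => J.prod J) (μ.prod μ) :=
    measurePreserving_arrowProdEquivProdArrow _ _ _ _ _
  set G : (Fin n → Example) × (Fin n → Example) → ℝ≥0∞ := fun s => ghostSup F (e.symm s) with hG
  have hGm : AEMeasurable G (μ.prod μ) := by
    have hps := hp.symm e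
    exact (universallyMeasurable_ghostSup hF _ inferInstance).comp_quasiMeasurePreserving
      hps.quasiMeasurePreserving
  have hGint : ∫⁻ s, G s ∂(μ.prod μ) ≤ ENNReal.ofReal (deviationBound n d x r) := by
    rw [← hp.map_eq, lintegral_map_equiv]
    simp only [hG, MeasurableEquiv.symm_apply_apply]
    exact lintegral_ghostSup_le hF hn hd J h0 h1 hr
  rw [lintegral_prod _ hGm] at hGint
  -- Integrating out only the ghost sample leaves a function of the sample that dominates all
  -- deviations at once, since each expectation is the mean over a ghost sample. Markov's inequality
  -- for `Ψ` then suffices.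
  set Ψ : (Fin n → Example) → ℝ≥0∞ := fun s => ∫⁻ s', G (s, s') ∂μ with hΨ
  have hΨm : AEMeasurable Ψ μ := hGm.lintegral_prod_right'
  have hdev : ∀ s, ∀ f ∈ F, ∀ w, ENNReal.ofReal (sampleMean (fun z => signedHit w (f z.1) z.2) s
          - ∫ z, signedHit w (f z.1) z.2 ∂J) ≤ Ψ s := by
    intro s f hf w
    have hi : Integrable (fun z : Example => signedHit w (f z.1) z.2) J :=
      integrable_of_abs_le (measurable_signedHit_comp w (hm f hf)) fun z => abs_signedHit_le _ _ _
    obtain ⟨hI, hE⟩ := integral_sampleMean hn J hi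
    have hc : sampleMean (fun z => signedHit w (f z.1) z.2) s - ∫ z, signedHit w (f z.1) z.2 ∂J
        = ∫ s', (sampleMean (fun z => signedHit w (f z.1) z.2) s
          - sampleMean (fun z => signedHit w (f z.1) z.2) s') ∂μ := by
      rw [integral_sub (integrable_const _) hI, hE, integral_const]
      simp
    rw [hc]
    refine (ofReal_integral_le_lintegral ((integrable_const _).sub hI)).trans
      (lintegral_mono fun s' => ?_)
    refine le_trans (le_of_eq ?_) (ofReal_ghostDiff_le_ghostSup hf w (e.symm (s, s')))
    congr 1
    simp only [sampleMean, ghostDiff, doublePoints, Sum.elim_inl, Sum.elim_inr, Pi.sub_apply]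
    rw [← mul_sub, ← Finset.sum_sub_distrib]
    rfl
  refine ⟨{s | Ψ s < ENNReal.ofReal t}, hΨm.nullMeasurable measurableSet_Iio, ?_, ?_⟩
  · have hmark := mul_meas_ge_le_lintegral₀ hΨm (ENNReal.ofReal t)
    have hset : {s | Ψ s < ENNReal.ofReal t}ᶜ = {s | ENNReal.ofReal t ≤ Ψ s} := by
      ext s; simp
    have hN : NullMeasurableSet {s | Ψ s < ENNReal.ofReal t} μ :=
      hΨm.nullMeasurable measurableSet_Iio
    have hc := probReal_compl_eq_one_sub₀ hN
    rw [hset] at hc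
    have h2 := hmark.trans hGint
    have hB0 : 0 ≤ deviationBound n d x r := by
      have : 0 ≤ Real.log (1 / x) := Real.log_nonneg (by rw [le_div_iff₀ h0]; linarith)
      rw [deviationBound]
      positivity
    have h3 : t * μ.real {s | ENNReal.ofReal t ≤ Ψ s} ≤ deviationBound n d x r := by
      have := ENNReal.toReal_mono (by simp) h2
      rw [ENNReal.toReal_mul, ENNReal.toReal_ofReal ht.le, ENNReal.toReal_ofReal hB0] at this
      exact this
    have h4 : 3 * (t * μ.real {s | ENNReal.ofReal t ≤ Ψ s}) ≤ t := by linarith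
    have h5 : μ.real {s | ENNReal.ofReal t ≤ Ψ s} ≤ 1 / 3 := by
      by_contra! hcon
      nlinarith
    linarith
  · intro s hs f hf w
    have := (hdev s f hf w).trans_lt hs
    exact ((ENNReal.ofReal_lt_ofReal_iff ht).1 this).le

/-! ### The tester -/

lemma card_le_of_vcDim_le {F : Set (unitInterval → ℤˣ)} {d : ℕ} (h : vcDim F ≤ d)
    (S : Finset unitInterval) (hS : Shatters F S) : S.card ≤ d := by
  have : (S.card : ℕ∞) ≤ vcDim F := le_iSup₂_of_le S hS le_rfl
  exact_mod_cast this.trans h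

/-- The point `1/2` is shattered by the thresholds at `1/2` and `1` of the identity. This lets `d *
log (2 / ε)` absorb additive constants in the sample size. -/
lemma one_le_vcDim_thr {K : Set (unitInterval → unitInterval)} (hK : IsValidPostProcessing K) :
    1 ≤ vcDim (thr K) := by
  have hh : (1 / 2 : ℝ) ∈ Set.Icc (0 : ℝ) 1 := by norm_num
  set a : unitInterval := ⟨1 / 2, hh⟩ with ha
  refine le_iSup₂_of_le {a} ?_ (by simp)
  intro g
  have hmem : a ∈ (({a} : Finset unitInterval) : Set unitInterval) := by simp
  rcases Int.units_eq_one_or (g ⟨a, hmem⟩) with h | h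
  · refine ⟨_, signPlus_sub_mem_thr hK hK.identity (1 / 2), ?_⟩
    rintro ⟨p, hp⟩
    obtain rfl : p = a := by simpa using hp
    rw [h]
    simp [signPlus, ha]
  · refine ⟨_, signPlus_sub_mem_thr hK hK.identity 1, ?_⟩
    rintro ⟨p, hp⟩
    obtain rfl : p = a := by simpa using hp
    rw [h]
    norm_num [signPlus, ha]

/-- The loss gap between the decisions `g(p)` and `f(p)` at tip `v`. -/
def pairGap (f g : unitInterval → ℤˣ) (v : ℝ) (z : Example) : ℝ :=
  (signReal (f z.1) - signReal (g z.1)) * (outcome z.2 - v)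

/-- Writing `y - v` as `(1 - v) 1[y = 1] - v 1[y = 0]` gives nonnegative weights of sum `1` for each
of `f` and `g`. One-sided deviations `t` thus give `2 * t`, uniformly in `v`. -/
lemma pairGap_eq (f g : unitInterval → ℤˣ) (v : ℝ) (z : Example) :
    pairGap f g v z =
      (1 - v) * signedHit (true, 1) (f z.1) z.2 + v * signedHit (false, -1) (f z.1) z.2
      + ((1 - v) * signedHit (true, -1) (g z.1) z.2 + v * signedHit (false, 1) (g z.1) z.2) := by
  have h1 : signReal 1 = 1 := by simp [signReal]
  have h2 : signReal (-1) = -1 := by simp [signReal]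
  obtain ⟨p, y⟩ := z
  cases y <;> simp [pairGap, signedHit, outcome, h1, h2] <;> ring

lemma sampleMean_pairGap_sub_le {F : Set (unitInterval → ℤˣ)} (hm : ∀ f ∈ F, Measurable f) {n : ℕ}
    {J : Measure Example} [IsProbabilityMeasure J] {s : Fin n → Example} {t : ℝ}
    (hs : ∀ f ∈ F, ∀ w, sampleMean (fun z => signedHit w (f z.1) z.2) s
          - ∫ z, signedHit w (f z.1) z.2 ∂J ≤ t)
    {f g : unitInterval → ℤˣ} (hf : f ∈ F) (hg : g ∈ F) {v : ℝ} (hv : v ∈ Set.Icc (0 : ℝ) 1) :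
    sampleMean (pairGap f g v) s - ∫ z, pairGap f g v z ∂J ≤ 2 * t := by
  have hi : ∀ f ∈ F, ∀ w, Integrable (fun z : Example => signedHit w (f z.1) z.2) J :=
    fun f hf w => integrable_of_abs_le (measurable_signedHit_comp w (hm f hf))
      fun z => abs_signedHit_le _ _ _
  have e1 : ∫ z, pairGap f g v z ∂J =
      (1 - v) * ∫ z, signedHit (true, 1) (f z.1) z.2 ∂J
      + v * ∫ z, signedHit (false, -1) (f z.1) z.2 ∂J
      + ((1 - v) * ∫ z, signedHit (true, -1) (g z.1) z.2 ∂J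
      + v * ∫ z, signedHit (false, 1) (g z.1) z.2 ∂J) := by
    simp only [pairGap_eq]
    have hi2 : ∀ f ∈ F, ∀ w w' a b, Integrable (fun z : Example =>
        a * signedHit w (f z.1) z.2 + b * signedHit w' (f z.1) z.2) J :=
      fun f hf w w' a b => ((hi f hf w).const_mul a).add ((hi f hf w').const_mul b)
    rw [integral_add (hi2 f hf _ _ _ _) (hi2 g hg _ _ _ _),
      integral_add ((hi f hf _).const_mul _) ((hi f hf _).const_mul _),
      integral_add ((hi g hg _).const_mul _) ((hi g hg _).const_mul _)]
    simp only [integral_const_mul]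
  have e2 : sampleMean (pairGap f g v) s =
      (1 - v) * sampleMean (fun z => signedHit (true, 1) (f z.1) z.2) s
      + v * sampleMean (fun z => signedHit (false, -1) (f z.1) z.2) s
      + ((1 - v) * sampleMean (fun z => signedHit (true, -1) (g z.1) z.2) s
      + v * sampleMean (fun z => signedHit (false, 1) (g z.1) z.2) s) := by
    simp only [sampleMean, pairGap_eq, Finset.sum_add_distrib, ← Finset.mul_sum]
    ring
  rw [e1, e2]
  have v0 := hv.1
  have v1 : 0 ≤ 1 - v := sub_nonneg.2 hv.2
  have a1 := mul_le_mul_of_nonneg_left (hs f hf (true, 1)) v1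
  have a2 := mul_le_mul_of_nonneg_left (hs f hf (false, -1)) v0
  have a3 := mul_le_mul_of_nonneg_left (hs g hg (true, -1)) v1
  have a4 := mul_le_mul_of_nonneg_left (hs g hg (false, 1)) v0
  linarith

lemma abs_sampleMean_gapAt_sub_le {K : Set (unitInterval → unitInterval)}
    (hK : IsValidPostProcessing K) (hm : ∀ k ∈ K, Measurable k) {n : ℕ}
    {J : Measure Example} [IsProbabilityMeasure J] {s : Fin n → Example} {t : ℝ}
    (hs : ∀ f ∈ thr K, ∀ w, sampleMean (fun z => signedHit w (f z.1) z.2) s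
          - ∫ z, signedHit w (f z.1) z.2 ∂J ≤ t)
    {f : unitInterval → ℤˣ} (hf : f ∈ thr K) {v : ℝ} (hv : v ∈ Set.Icc (0 : ℝ) 1) :
    |sampleMean (gapAt f v) s - ∫ z, gapAt f v z ∂J| ≤ 2 * t := by
  set g : unitInterval → ℤˣ := fun p => signPlus ((p : ℝ) - v) with hg
  have hgm : g ∈ thr K := signPlus_sub_mem_thr hK hK.identity v
  have hmF : ∀ f ∈ thr K, Measurable f := fun f hf => measurable_of_mem_thr hm hf
  have h1 := sampleMean_pairGap_sub_le hmF hs hf hgm hv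
  have h2 := sampleMean_pairGap_sub_le hmF hs hgm hf hv
  have e1 : pairGap f g v = gapAt f v := rfl
  have e2 : pairGap g f v = fun z => -gapAt f v z := by
    funext z
    simp only [pairGap, gapAt, hg]
    ring
  rw [e1] at h1
  rw [e2, integral_neg] at h2
  have e3 : sampleMean (fun z => -gapAt f v z) s = -sampleMean (gapAt f v) s := by
    simp [sampleMean]
  rw [e3] at h2
  rw [abs_le]
  constructor <;> linarith

/-- The samples on which all empirical loss gaps are at most `c`. -/
def acceptSet (K : Set (unitInterval → unitInterval)) (n : ℕ) (c : ℝ) : Set (Fin n → Example) :=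
  {s | ∀ f ∈ thr K, ∀ q : ℚ, (q : ℝ) ∈ Set.Icc (0 : ℝ) 1 → sampleMean (gapAt f q) s ≤ c}

/-- For a fixed realized pattern the condition is a countable intersection over rational tips, and
there are finitely many patterns. -/
lemma universallyMeasurableSet_acceptSet {K : Set (unitInterval → unitInterval)}
    (hC : IsMeasurableClass (thr K)) (n : ℕ) (c : ℝ) :
    UniversallyMeasurableSet (acceptSet K n c) := by
  intro μ hμ
  set val : (Fin n → ℤˣ) → ℚ → (Fin n → Example) → ℝ := fun σ q s => (1 / (n : ℝ)) * ∑ i,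
    (signReal (σ i) - signReal (signPlus (((s i).1 : ℝ) - q))) * (outcome (s i).2 - q) with hval
  have hvalm : ∀ σ q, Measurable (val σ q) := by
    intro σ q
    refine Measurable.const_mul (Finset.measurable_sum _ fun i _ => ?_) _
    refine Measurable.mul (Measurable.sub measurable_const (measurable_signReal.comp
      (measurable_signPlus.comp (Measurable.sub_const ?_ _)))) (Measurable.sub_const
      (measurable_outcome.comp (by fun_prop)) _)
    exact measurable_subtype_coe.comp (by fun_prop)
  have e : acceptSet K n c = ⋂ σ : Fin n → ℤˣ,
      {s | ∃ f ∈ thr K, ∀ i, f ((fun (s : Fin n → Example) i => (s i).1) s i) = σ i}ᶜ ∪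
        ⋂ q : ℚ, {s | (q : ℝ) ∈ Set.Icc (0 : ℝ) 1 → val σ q s ≤ c} := by
    ext s
    simp only [acceptSet, Set.mem_ofPred_eq, Set.mem_iInter, Set.mem_union, Set.mem_compl_iff]
    constructor
    · intro h σ
      by_cases hσ : ∃ f ∈ thr K, ∀ i, f (s i).1 = σ i
      · right
        obtain ⟨f, hf, hfσ⟩ := hσ
        intro q hq
        have := h f hf q hq
        simpa only [sampleMean, gapAt, hfσ, hval] using this
      · exact Or.inl hσ
    · intro h f hf q hq
      rcases h (fun i => f (s i).1) with h | h
      · exact absurd ⟨f, hf, fun _ => rfl⟩ h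
      · exact h q hq
  rw [e]
  refine NullMeasurableSet.iInter fun σ => NullMeasurableSet.union ?_ ?_
  · refine (hC.setOf_pattern (measurable_pi_lambda _ fun i => ?_) σ μ hμ).compl
    fun_prop
  · refine (MeasurableSet.iInter fun q => ?_).nullMeasurableSet
    by_cases hq : (q : ℝ) ∈ Set.Icc (0 : ℝ) 1
    · simp only [hq, true_imp_iff]
      exact measurableSet_le (hvalm σ q) measurable_const
    · simp [hq]

/-- The test that accepts the samples in a set. -/
def indicatorTest {n : ℕ} {S : Set (Fin n → Example)} (hS : UniversallyMeasurableSet S) :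
    RandomizedTest n where
  accept := S.indicator 1
  measurable_accept := fun μ hμ => (aemeasurable_const (b := (1 : unitInterval))).indicator₀ (hS μ hμ)

lemma probAccept_indicatorTest {n : ℕ} {S : Set (Fin n → Example)}
    (hS : UniversallyMeasurableSet S) (J : Measure Example) [IsProbabilityMeasure J] :
    (indicatorTest hS).probAccept J = (Measure.pi fun _ : Fin n => J).real S := by
  have hn := hS (Measure.pi fun _ : Fin n => J) inferInstance
  rw [RandomizedTest.probAccept, ← mul_one ((Measure.pi fun _ : Fin n => J).real S),
    ← smul_eq_mul, ← setIntegral_const, ← integral_indicator₀ hn]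
  congr 1
  funext s
  by_cases h : s ∈ S <;> simp [indicatorTest, h]

lemma probReject_indicatorTest {n : ℕ} {S : Set (Fin n → Example)}
    (hS : UniversallyMeasurableSet S) (J : Measure Example) [IsProbabilityMeasure J] :
    (indicatorTest hS).probReject J = (Measure.pi fun _ : Fin n => J).real Sᶜ := by
  have hn := (hS (Measure.pi fun _ : Fin n => J) inferInstance).compl
  rw [RandomizedTest.probReject, ← mul_one ((Measure.pi fun _ : Fin n => J).real Sᶜ),
    ← smul_eq_mul, ← setIntegral_const, ← integral_indicator₀ hn]
  congr 1
  funext s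
  by_cases h : s ∈ S <;> simp [indicatorTest, h]

/-- A uniform deviation bound of `ε / 4` makes the empirical test a tester. -/
lemma isTester_indicatorTest {K : Set (unitInterval → unitInterval)}
    (hK : IsValidPostProcessing K) (hm : ∀ k ∈ K, Measurable k)
    (hC : IsMeasurableClass (thr K)) {d n : ℕ} (hd : vcDim (thr K) ≤ d) (hn : 0 < n)
    {α ε x r : ℝ} (hε : 0 < ε) (h0 : 0 < x) (h1 : x ≤ 1) (hr : 0 < r)
    (hB : 3 * deviationBound n d x r ≤ ε / 4) :
    IsTester K α (α - ε) (indicatorTest (universallyMeasurableSet_acceptSet hC n (α - ε / 2))) := by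
  intro J hJ
  obtain ⟨E, -, hE, hdev⟩ := exists_uniform_deviation hC (fun f hf => measurable_of_mem_thr hm hf)
    hn (card_le_of_vcDim_le hd) J h0 h1 hr (by positivity) hB
  refine ⟨fun hcdl => ?_, fun hcdl => ?_⟩
  · rw [probReject_indicatorTest]
    refine hE.trans (measureReal_mono fun s hs => ?_)
    obtain ⟨f, hf, q, hq, hlt⟩ : ∃ f ∈ thr K, ∃ q : ℚ, (q : ℝ) ∈ Set.Icc (0 : ℝ) 1 ∧
        α < ∫ z, gapAt f q z ∂J := by
      -- Deviations are at most `2 * (ε / 4) = ε / 2`, the distance from the cutoff `α - ε / 2` to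
      -- both `α` and `α - ε`.
      by_contra! hcon
      exact absurd (cdl_le_of_integral_gapAt_le hK hm J hcon) (not_le.2 hcdl)
    intro hacc
    have h2 := hacc f hf q hq
    have h3 := (abs_le.1 (abs_sampleMean_gapAt_sub_le hK hm (hdev s hs) hf hq)).1
    linarith
  · rw [probAccept_indicatorTest]
    refine hE.trans (measureReal_mono fun s hs f hf q hq => ?_)
    have h2 := integral_gapAt_le_cdl hK J hf hq
    have h3 := (abs_le.1 (abs_sampleMean_gapAt_sub_le hK hm (hdev s hs) hf hq)).2
    linarith

/-- Both summands of `deviationBound` are made at most `ε / 24`. This allows a numerator `n ε² /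
1152`, half of which is `2 n x`. The other half is at least `17 d L`, since `39168 = 17 * 2304`: `14
d L` for the logarithm of `1 / x` and `3 d L` for the constant `2`. -/
lemma three_mul_deviationBound_le {d n : ℕ} (hd : 1 ≤ d) {ε : ℝ} (hε : 0 < ε) (hε1 : ε < 1)
    (hn : 39168 * ((d : ℝ) * Real.log (2 / ε) / ε ^ 2) ≤ n) (hn0 : 0 < n) :
    3 * deviationBound n d (ε ^ 2 / 4608) (ε / 48) ≤ ε / 4 := by
  have hn' : (0 : ℝ) < n := by exact_mod_cast hn0
  have hd' : (1 : ℝ) ≤ d := by exact_mod_cast hd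
  set L := Real.log (2 / ε) with hL
  have hlog2 := Real.log_two_gt_d9
  have hL2 : Real.log 2 ≤ L := by
    apply Real.log_le_log (by norm_num)
    rw [le_div_iff₀ hε]; linarith
  have hx : Real.log (1 / (ε ^ 2 / 4608)) ≤ 14 * L := by
    have h1 : 1 / (ε ^ 2 / 4608) ≤ (2 ^ 6 * (2 / ε)) ^ 2 := by
      rw [one_div_div, mul_pow, div_pow, ← mul_div_assoc]
      apply div_le_div_of_nonneg_right _ (by positivity)
      norm_num
    have h2 := Real.log_le_log (by positivity) h1
    rw [Real.log_pow, Real.log_mul (by norm_num) (by positivity), Real.log_pow] at h2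
    push_cast at h2
    linarith
  have hdL : L ≤ d * L := le_mul_of_one_le_left (by linarith) hd'
  have hnε : 39168 * (d * L) ≤ n * ε ^ 2 := by
    rw [← mul_div_assoc, div_le_iff₀ (by positivity)] at hn
    exact hn
  have hnum : 2 + 2 * n * (ε ^ 2 / 4608) + d * Real.log (1 / (ε ^ 2 / 4608)) ≤
      n * ε ^ 2 / 1152 := by
    have := mul_le_mul_of_nonneg_left hx (by positivity : (0 : ℝ) ≤ d)
    nlinarith
  have h3 : (2 + 2 * n * (ε ^ 2 / 4608) + d * Real.log (1 / (ε ^ 2 / 4608))) / (ε / 48 * n)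
      ≤ ε / 24 := by
    rw [div_le_iff₀ (by positivity)]
    refine hnum.trans (le_of_eq ?_)
    ring
  rw [deviationBound]
  linarith

theorem exists_tester {K : Set (unitInterval → unitInterval)} (hK : IsValidPostProcessing K)
    (hm : ∀ k ∈ K, Measurable k) (hC : IsMeasurableClass (thr K)) {d : ℕ}
    (hd : vcDim (thr K) = d) (α : ℝ) {ε : ℝ} (hε : 0 < ε) (hε1 : ε < 1) :
    ∃ m : ℕ, (m : ℝ) ≤ 40000 * ((d : ℝ) * Real.log (2 / ε) / ε ^ 2) ∧
      ∃ A : RandomizedTest m, IsTester K α (α - ε) A := by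
  have hd1 : 1 ≤ d := by
    have := one_le_vcDim_thr hK
    rw [hd] at this
    exact_mod_cast this
  have hd' : (1 : ℝ) ≤ d := by exact_mod_cast hd1
  set Q := (d : ℝ) * Real.log (2 / ε) / ε ^ 2 with hQ
  have hQ1 : 1 / 2 ≤ Q := by
    have hL2 : Real.log 2 ≤ Real.log (2 / ε) := by
      apply Real.log_le_log (by norm_num)
      rw [le_div_iff₀ hε]; linarith
    have hlog2 := Real.log_two_gt_d9
    rw [hQ, le_div_iff₀ (by positivity)]
    nlinarith
  -- Rounding up costs at most `1 ≤ 2 * Q`, which the constant `40000` accommodates.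
  have hpos : 0 < ⌈39168 * Q⌉₊ := Nat.ceil_pos.2 (by linarith)
  refine ⟨⌈39168 * Q⌉₊, ?_, _, isTester_indicatorTest hK hm hC hd.le hpos hε
    (x := ε ^ 2 / 4608) (r := ε / 48) (by positivity) (by nlinarith) (by positivity)
    (three_mul_deviationBound_le hd1 hε hε1 (Nat.le_ceil _) hpos)⟩
  have := (Nat.ceil_lt_add_one (by linarith : 0 ≤ 39168 * Q)).le
  linarith

/-! ### The lower bound for auditors -/

/-- A point uniform in `S` with a label drawn from the weights `w`. -/
def labelLaw (S : Finset unitInterval) (w : S → Bool → ℝ) : Measure (S × Bool) :=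
  ∑ z, ENNReal.ofReal (w z.1 z.2 / S.card) • Measure.dirac z

/-- The forgetful map to labelled examples. -/
def toExample {S : Finset unitInterval} (z : S × Bool) : Example := (z.1, z.2)

/-- The law of labelled examples given by `labelLaw`. -/
def exampleLaw (S : Finset unitInterval) (w : S → Bool → ℝ) : Measure Example :=
  (labelLaw S w).map toExample

variable {S : Finset unitInterval}

lemma measurable_toExample : Measurable (toExample (S := S)) := measurable_of_countable _

lemma labelLaw_singleton (w : S → Bool → ℝ) (z : S × Bool) :
    labelLaw S w {z} = ENNReal.ofReal (w z.1 z.2 / S.card) := by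
  classical
  rw [labelLaw, Measure.finsetSum_apply]
  rw [Finset.sum_eq_single z]
  · simp
  · intro z' _ hz'
    simp [hz']
  · simp

instance (w : S → Bool → ℝ) : IsFiniteMeasure (labelLaw S w) := by
  refine ⟨?_⟩
  rw [labelLaw, Measure.finsetSum_apply]
  refine ENNReal.sum_lt_top.2 fun z _ => ?_
  simp

/-- Conditional label probabilities. -/
structure IsLabelWeight (w : S → Bool → ℝ) : Prop where
  nonneg : ∀ p y, 0 ≤ w p y
  sum_eq_one : ∀ p, ∑ y, w p y = 1

lemma integral_labelLaw {w : S → Bool → ℝ} (hw : IsLabelWeight w) (f : S × Bool → ℝ) :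
    ∫ z, f z ∂(labelLaw S w) = ∑ z, w z.1 z.2 / S.card * f z := by
  rw [integral_fintype Integrable.of_finite]
  refine Finset.sum_congr rfl fun z _ => ?_
  rw [measureReal_def, labelLaw_singleton, ENNReal.toReal_ofReal
    (div_nonneg (hw.nonneg _ _) (Nat.cast_nonneg _)), smul_eq_mul]

lemma isProbabilityMeasure_labelLaw (hS : S.Nonempty) {w : S → Bool → ℝ} (hw : IsLabelWeight w) :
    IsProbabilityMeasure (labelLaw S w) := by
  have hc : (S.card : ℝ) ≠ 0 := by exact_mod_cast hS.card_pos.ne'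
  have h := integral_labelLaw hw fun _ => 1
  simp only [integral_const, smul_eq_mul, mul_one, Fintype.sum_prod_type, ← Finset.sum_div,
    hw.sum_eq_one, Finset.sum_const, Finset.card_univ, Fintype.card_coe, nsmul_eq_mul,
    div_self hc] at h
  refine ⟨?_⟩
  rwa [measureReal_def, ENNReal.toReal_eq_one_iff] at h

lemma isProbabilityMeasure_exampleLaw (hS : S.Nonempty) {w : S → Bool → ℝ}
    (hw : IsLabelWeight w) : IsProbabilityMeasure (exampleLaw S w) :=
  have := isProbabilityMeasure_labelLaw hS hw
  Measure.isProbabilityMeasure_map measurable_toExample.aemeasurable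

lemma integral_exampleLaw {w : S → Bool → ℝ} (hw : IsLabelWeight w) {f : Example → ℝ}
    (hf : Measurable f) :
    ∫ z, f z ∂(exampleLaw S w) = ∑ p : S, ∑ y, w p y / S.card * f (p, y) := by
  rw [exampleLaw, integral_map measurable_toExample.aemeasurable hf.aestronglyMeasurable,
    integral_labelLaw hw, Fintype.sum_prod_type]
  rfl

/-- The sample law is the push-forward of a law on the finite space of `S`-valued samples, so a
merely universally measurable acceptance function integrates to a finite sum. -/
lemma probAccept_exampleLaw (hS : S.Nonempty) {w : S → Bool → ℝ} (hw : IsLabelWeight w) {m : ℕ}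
    (A : RandomizedTest m) :
    A.probAccept (exampleLaw S w) = ∑ q : Fin m → S, ∑ y : Fin m → Bool,
      (∏ i, w (q i) (y i)) / (S.card : ℝ) ^ m * (A.accept fun i => (↑(q i), y i) : ℝ) := by
  have := isProbabilityMeasure_labelLaw hS hw
  have := isProbabilityMeasure_exampleLaw hS hw
  have hpi : (Measure.pi fun _ : Fin m => exampleLaw S w)
      = (Measure.pi fun _ : Fin m => labelLaw S w).map fun s i => toExample (s i) := by
    have : ∀ i : Fin m, SigmaFinite ((labelLaw S w).map toExample) := fun _ =>
      inferInstanceAs (SigmaFinite (exampleLaw S w))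
    rw [Measure.pi_map_pi fun _ => measurable_toExample.aemeasurable]
    rfl
  have hm : AEMeasurable (fun s => (A.accept s : ℝ)) (Measure.pi fun _ : Fin m => exampleLaw S w) :=
    measurable_subtype_coe.comp_aemeasurable (A.measurable_accept _ inferInstance)
  rw [RandomizedTest.probAccept]
  rw [hpi] at hm ⊢
  rw [integral_map (measurable_of_countable _).aemeasurable hm.aestronglyMeasurable,
    integral_fintype Integrable.of_finite,
    ← (Equiv.arrowProdEquivProdArrow (Fin m) (fun _ => S) (fun _ => Bool)).symm.sum_comp,
    Fintype.sum_prod_type]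
  refine Finset.sum_congr rfl fun q _ => Finset.sum_congr rfl fun y _ => ?_
  rw [smul_eq_mul]
  congr 1
  rw [measureReal_def, Measure.pi_singleton, ENNReal.toReal_prod]
  simp only [labelLaw_singleton]
  rw [Finset.prod_congr rfl fun i _ => ENNReal.toReal_ofReal
    (div_nonneg (hw.nonneg _ _) (Nat.cast_nonneg _)), Finset.prod_div_distrib]
  simp [Equiv.arrowProdEquivProdArrow]

lemma probAccept_add_probReject {m : ℕ} (A : RandomizedTest m) (J : Measure Example)
    [IsProbabilityMeasure J] : A.probAccept J + A.probReject J = 1 := by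
  have hm : AEMeasurable (fun s => (A.accept s : ℝ)) (Measure.pi fun _ : Fin m => J) :=
    measurable_subtype_coe.comp_aemeasurable (A.measurable_accept _ inferInstance)
  have hi : Integrable (fun s => (A.accept s : ℝ)) (Measure.pi fun _ : Fin m => J) :=
    Integrable.of_bound hm.aestronglyMeasurable 1 (Filter.Eventually.of_forall fun s => by
      rw [Real.norm_eq_abs, abs_of_nonneg (A.accept s).2.1]
      exact (A.accept s).2.2)
  rw [RandomizedTest.probAccept, RandomizedTest.probReject,
    integral_sub (integrable_const _) hi]
  simp

/-! ### Mixtures of deterministic labellings and collisions. -/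

/-- The weights of the deterministic labelling `b`. -/
def labelWeight (b : S → Bool) (p : S) (y : Bool) : ℝ := if b p = y then 1 else 0

lemma isLabelWeight_labelWeight (b : S → Bool) : IsLabelWeight (labelWeight b) :=
  ⟨fun p y => by unfold labelWeight; split_ifs <;> norm_num, fun p => by simp [labelWeight]⟩

/-- At distinct points, random deterministic labels are independent draws. -/
lemma sum_prod_mul_prod_labelWeight {ι κ : Type*} [Fintype ι] [Fintype κ] [DecidableEq κ]
    {w : κ → Bool → ℝ} (hw : ∀ k, ∑ y, w k y = 1) {q : ι → κ} (hq : Function.Injective q)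
    (y : ι → Bool) :
    ∑ b : κ → Bool, (∏ k, w k (b k)) * ∏ i, (if b (q i) = y i then (1 : ℝ) else 0)
      = ∏ i, w (q i) (y i) := by
  -- Regrouping by points `k` makes the sum over labellings factorize; unsampled points contribute
  -- total weight `1`, and by injectivity a sampled point meets only one constraint.
  have e : ∀ b : κ → Bool, (∏ k, w k (b k)) * ∏ i, (if b (q i) = y i then (1 : ℝ) else 0)
      = ∏ k, (w k (b k) * ∏ i, (if q i = k then (if b k = y i then (1 : ℝ) else 0) else 1)) := by
    intro b
    rw [Finset.prod_mul_distrib, Finset.prod_comm]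
    congr 1
    refine Finset.prod_congr rfl fun i _ => ?_
    simp
  simp only [e]
  rw [← Fintype.piFinset_univ, ← Finset.prod_univ_sum (fun _ => Finset.univ)
    (fun k c => w k c * ∏ i, (if q i = k then (if c = y i then (1 : ℝ) else 0) else 1))]
  symm
  refine Fintype.prod_of_injective q hq _ _ (fun k hk => ?_) fun i => ?_
  · refine (Finset.sum_congr rfl fun c _ => ?_).trans (hw k)
    rw [Finset.prod_eq_one, mul_one]
    intro i _
    rw [if_neg]
    rintro rfl
    exact hk ⟨i, rfl⟩
  · have : ∀ c, ∏ j, (if q j = q i then (if c = y j then (1 : ℝ) else 0) else 1)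
        = if c = y i then 1 else 0 := by
      intro c
      rw [Finset.prod_eq_single i]
      · simp
      · intro j _ hj
        rw [if_neg (hq.ne hj)]
      · simp
    simp [this]

/-- The birthday bound. -/
lemma card_not_injective_le {κ : Type*} [Fintype κ] [DecidableEq κ] [Nonempty κ] (m : ℕ) :
    (((Finset.univ.filter fun q : Fin m → κ => ¬Function.Injective q).card : ℝ))
      ≤ (m : ℝ) ^ 2 / Fintype.card κ * (Fintype.card κ : ℝ) ^ m := by
  set d := Fintype.card κ with hd
  have hd0 : (0 : ℝ) < d := by exact_mod_cast Fintype.card_pos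
  have hinj : (Finset.univ.filter fun q : Fin m → κ => Function.Injective q).card
      = d.descFactorial m := by
    rw [← Fintype.card_subtype, Fintype.card_congr (Equiv.subtypeInjectiveEquivEmbedding _ _),
      Fintype.card_embedding_eq, Fintype.card_fin]
  have hsum := Finset.card_filter_add_card_filter_not (s := (Finset.univ : Finset (Fin m → κ)))
    (fun q => Function.Injective q)
  rw [hinj, Finset.card_univ, Fintype.card_fun, Fintype.card_fin] at hsum
  have hsum' : (d.descFactorial m : ℝ)
      + (Finset.univ.filter fun q : Fin m → κ => ¬Function.Injective q).card = (d : ℝ) ^ m := by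
    exact_mod_cast hsum
  -- Bernoulli's inequality for `(1 - m / d) ^ m` when `m ≤ d`; otherwise the left side is
  -- nonpositive.
  have hlow : (1 - (m : ℝ) ^ 2 / d) * (d : ℝ) ^ m ≤ d.descFactorial m := by
    by_cases hmd : m ≤ d
    · have h1 : ((d : ℝ) - m) ^ m ≤ d.descFactorial m := by
        have h2 : (d - m) ^ m ≤ d.descFactorial m :=
          (Nat.pow_le_pow_left (by omega) m).trans (Nat.pow_sub_le_descFactorial d m)
        rw [← Nat.cast_sub hmd]
        exact_mod_cast h2
      have h3 : 1 + (m : ℝ) * (-(m / d)) ≤ (1 + -((m : ℝ) / d)) ^ m := by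
        apply one_add_mul_le_pow
        have : (m : ℝ) / d ≤ 1 := (div_le_one hd0).2 (by exact_mod_cast hmd)
        linarith
      have h4 : ((d : ℝ) - m) ^ m = (1 + -((m : ℝ) / d)) ^ m * (d : ℝ) ^ m := by
        rw [← mul_pow]
        congr 1
        field_simp
        ring
      have h5 : 1 - (m : ℝ) ^ 2 / d = 1 + (m : ℝ) * (-(m / d)) := by ring
      rw [h5]
      refine le_trans ?_ h1
      rw [h4]
      gcongr
    · have h1 : (d : ℝ) ≤ m := by exact_mod_cast (not_le.1 hmd).le
      have h2 : 1 - (m : ℝ) ^ 2 / d ≤ 0 := by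
        rw [sub_nonpos, one_le_div hd0]
        have : (1 : ℝ) ≤ d := by exact_mod_cast Fintype.card_pos
        nlinarith
      exact (mul_nonpos_of_nonpos_of_nonneg h2 (by positivity)).trans (Nat.cast_nonneg _)
  linarith

/-- Few samples do not distinguish random labels from random deterministic labellings. -/
lemma probAccept_le_of_forall_labelWeight (hS : S.Nonempty) {w : S → Bool → ℝ}
    (hw : IsLabelWeight w) {m : ℕ} (A : RandomizedTest m) {a : ℝ}
    (hA : ∀ b : S → Bool, A.probAccept (exampleLaw S (labelWeight b)) ≤ a) :
    A.probAccept (exampleLaw S w) ≤ a + (m : ℝ) ^ 2 / S.card := by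
  classical
  have : Nonempty S := hS.to_subtype
  have hd0 : (0 : ℝ) < S.card := by exact_mod_cast hS.card_pos
  set acc : (Fin m → S) → (Fin m → Bool) → ℝ := fun q y => (A.accept fun i => (↑(q i), y i) : ℝ)
    with hacc
  have acc0 : ∀ q y, 0 ≤ acc q y := fun q y => (A.accept _).2.1
  have acc1 : ∀ q y, acc q y ≤ 1 := fun q y => (A.accept _).2.2
  have hprod0 : ∀ (q : Fin m → S) (y : Fin m → Bool), 0 ≤ ∏ i, w (q i) (y i) :=
    fun q y => Finset.prod_nonneg fun i _ => hw.nonneg _ _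
  have hWsum : ∑ b : S → Bool, ∏ p, w p (b p) = 1 := by
    rw [← Fintype.piFinset_univ, ← Finset.prod_univ_sum]
    exact Finset.prod_eq_one fun _ _ => hw.sum_eq_one _
  have hysum : ∀ q : Fin m → S, ∑ y : Fin m → Bool, ∏ i, w (q i) (y i) = 1 := by
    intro q
    rw [← Fintype.piFinset_univ, ← Finset.prod_univ_sum (fun _ => Finset.univ)
      (fun i c => w (q i) c)]
    exact Finset.prod_eq_one fun _ _ => hw.sum_eq_one _
  have havg : ∑ b : S → Bool, (∏ p, w p (b p)) * A.probAccept (exampleLaw S (labelWeight b)) ≤ a := by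
    calc _ ≤ ∑ b : S → Bool, (∏ p, w p (b p)) * a :=
          Finset.sum_le_sum fun b _ => mul_le_mul_of_nonneg_left (hA b)
            (Finset.prod_nonneg fun p _ => hw.nonneg _ _)
      _ = a := by rw [← Finset.sum_mul, hWsum, one_mul]
  have hswap : ∑ b : S → Bool, (∏ p, w p (b p)) * A.probAccept (exampleLaw S (labelWeight b))
      = ∑ q : Fin m → S, ∑ y : Fin m → Bool, (∑ b : S → Bool, (∏ p, w p (b p)) *
          ∏ i, (if b (q i) = y i then (1 : ℝ) else 0)) / (S.card : ℝ) ^ m * acc q y := by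
    simp only [probAccept_exampleLaw hS (isLabelWeight_labelWeight _), Finset.mul_sum]
    rw [Finset.sum_comm]
    refine Finset.sum_congr rfl fun q _ => ?_
    rw [Finset.sum_comm]
    refine Finset.sum_congr rfl fun y _ => ?_
    rw [Finset.sum_div, Finset.sum_mul]
    refine Finset.sum_congr rfl fun b _ => ?_
    simp only [labelWeight, hacc]
    ring
  -- Without collisions the mixture has exactly the law given by `w`; its colliding terms are
  -- nonnegative and may be dropped.
  have hge : ∑ q ∈ Finset.univ.filter (fun q : Fin m → S => Function.Injective q),
      ∑ y : Fin m → Bool, (∏ i, w (q i) (y i)) / (S.card : ℝ) ^ m * acc q y ≤ a := by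
    refine le_trans ?_ (hswap ▸ havg)
    calc _ = ∑ q ∈ Finset.univ.filter (fun q : Fin m → S => Function.Injective q),
          ∑ y : Fin m → Bool, (∑ b : S → Bool, (∏ p, w p (b p)) *
          ∏ i, (if b (q i) = y i then (1 : ℝ) else 0)) / (S.card : ℝ) ^ m * acc q y := by
          refine Finset.sum_congr rfl fun q hq => Finset.sum_congr rfl fun y _ => ?_
          rw [sum_prod_mul_prod_labelWeight hw.sum_eq_one (Finset.mem_filter.1 hq).2]
      _ ≤ _ := by
          refine Finset.sum_le_sum_of_subset_of_nonneg (Finset.filter_subset _ _) fun q _ _ =>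
            Finset.sum_nonneg fun y _ => mul_nonneg (div_nonneg (Finset.sum_nonneg fun b _ =>
              mul_nonneg (Finset.prod_nonneg fun p _ => hw.nonneg _ _)
                (Finset.prod_nonneg fun i _ => ?_)) (by positivity)) (acc0 q y)
          split_ifs <;> norm_num
  have hrest : ∑ q ∈ Finset.univ.filter (fun q : Fin m → S => ¬Function.Injective q),
      ∑ y : Fin m → Bool, (∏ i, w (q i) (y i)) / (S.card : ℝ) ^ m * acc q y
        ≤ (m : ℝ) ^ 2 / S.card := by
    calc _ ≤ ∑ q ∈ Finset.univ.filter (fun q : Fin m → S => ¬Function.Injective q),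
          1 / (S.card : ℝ) ^ m := by
          refine Finset.sum_le_sum fun q _ => ?_
          rw [← hysum q, Finset.sum_div]
          exact Finset.sum_le_sum fun y _ =>
            mul_le_of_le_one_right (div_nonneg (hprod0 q y) (by positivity)) (acc1 q y)
      _ ≤ _ := by
          rw [Finset.sum_const, nsmul_eq_mul, mul_one_div, div_le_iff₀ (by positivity)]
          simpa using card_not_injective_le (κ := S) m
  rw [probAccept_exampleLaw hS hw, ← Finset.sum_filter_add_sum_filter_not _
    (fun q : Fin m → S => Function.Injective q)]
  exact add_le_add hge hrest

/-- The calibrated weights `y ∼ Ber(p)`. -/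
def calibratedWeight (p : S) (y : Bool) : ℝ := if y then (p : unitInterval) else 1 - (p : unitInterval)

lemma isLabelWeight_calibratedWeight : IsLabelWeight (calibratedWeight (S := S)) := by
  refine ⟨fun p y => ?_, fun p => by simp [calibratedWeight]⟩
  cases y
  · simpa [calibratedWeight] using p.1.2.2
  · simpa [calibratedWeight] using p.1.2.1

/-- At each point, `p (1 - p) + (1 - p)(0 - p) = 0`, so the residual integrates to zero over every
event determined by `p`. -/
lemma ece_exampleLaw_calibratedWeight (hS : S.Nonempty) :
    ece (exampleLaw S calibratedWeight) = 0 := by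
  have hw := isLabelWeight_calibratedWeight (S := S)
  have := isProbabilityMeasure_exampleLaw hS hw
  set J := exampleLaw S calibratedWeight
  have hle : MeasurableSpace.comap (Prod.fst : Example → unitInterval) inferInstance
      ≤ (inferInstance : MeasurableSpace Example) := measurable_fst.comap_le
  have hfm : Measurable fun w : Example => outcome w.2 - (w.1 : ℝ) :=
    (measurable_outcome.comp measurable_snd).sub measurable_fst.subtype_val
  have hfi : Integrable (fun w : Example => outcome w.2 - (w.1 : ℝ)) J :=
    integrable_of_abs_le hfm fun z => abs_outcome_sub_le z.1.2 z.2
  have h0 : (fun _ => (0 : ℝ)) =ᵐ[J] J[fun w : Example => outcome w.2 - (w.1 : ℝ) |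
      MeasurableSpace.comap (Prod.fst : Example → unitInterval) inferInstance] := by
    refine ae_eq_condExp_of_forall_setIntegral_eq hle hfi
      (fun s _ _ => integrableOn_zero) (fun s hs _ => ?_) aestronglyMeasurable_const
    obtain ⟨B, hB, rfl⟩ := hs
    have hBm : MeasurableSet (Prod.fst ⁻¹' B : Set Example) := measurable_fst hB
    rw [integral_zero, ← integral_indicator hBm, integral_exampleLaw hw (hfm.indicator hBm)]
    symm
    refine Finset.sum_eq_zero fun p _ => ?_
    by_cases hp : (p : unitInterval) ∈ B
    · simp [calibratedWeight, Set.indicator, hp, outcome]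
      ring
    · simp [Set.indicator, hp]
  rw [ece, integral_congr_ae (g := fun _ => (0 : ℝ)), integral_zero]
  filter_upwards [h0] with z hz
  rw [← hz, abs_zero]

lemma integral_gapAt_exampleLaw (b : S → Bool) {f : unitInterval → ℤˣ} (hf : Measurable f)
    (v : ℝ) :
    ∫ z, gapAt f v z ∂(exampleLaw S (labelWeight b)) = (∑ p : S, gapAt f v (p, b p)) / S.card := by
  rw [integral_exampleLaw (isLabelWeight_labelWeight b) (measurable_gapAt hf v), Finset.sum_div]
  refine Finset.sum_congr rfl fun p _ => ?_
  rw [Finset.sum_eq_single (b p)]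
  · simp [labelWeight, div_eq_inv_mul]
  · intro y _ hy
    simp [labelWeight, hy.symm]
  · simp

/-- Deterministic labels on a shattered set near `1/2` have a large decision loss. -/
lemma lt_cdl_exampleLaw_labelWeight {K : Set (unitInterval → unitInterval)}
    (hK : IsValidPostProcessing K) (hm : ∀ k ∈ K, Measurable k) (hS : S.Nonempty)
    (hsh : Shatters (thr K) S)
    (hmid : ∀ p ∈ S, (7 / 16 : ℝ) ≤ p ∧ (p : ℝ) < 9 / 16) (b : S → Bool) :
    1 / 8 < cdl K (exampleLaw S (labelWeight b)) := by
  have hd0 : (S.card : ℝ) ≠ 0 := by exact_mod_cast hS.card_pos.ne'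
  have := isProbabilityMeasure_exampleLaw hS (isLabelWeight_labelWeight b)
  obtain ⟨f, hf, hfb⟩ := hsh fun p => if b p then 1 else -1
  have hfm := measurable_of_mem_thr hm hf
  -- At tip `7/16` the baseline decision is `+1` and each label `0` gains `7/8`; at tip `9/16` it is
  -- `-1` and each label `1` gains `7/8`. The two gaps add up to `7/8`, so one is at least `7/16 >
  -- 1/8`.
  have h1 := integral_gapAt_le_cdl hK (exampleLaw S (labelWeight b)) hf
    (v := 7 / 16) (by norm_num)
  have h2 := integral_gapAt_le_cdl hK (exampleLaw S (labelWeight b)) hf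
    (v := 9 / 16) (by norm_num)
  rw [integral_gapAt_exampleLaw b hfm] at h1 h2
  have hsum : (∑ p : S, gapAt f (7 / 16) (p, b p)) / S.card
      + (∑ p : S, gapAt f (9 / 16) (p, b p)) / S.card = 7 / 8 := by
    rw [← add_div, ← Finset.sum_add_distrib, Finset.sum_congr rfl (g := fun _ => (7 / 8 : ℝ))]
    · simp [hd0]
    · intro p _
      obtain ⟨m1, m2⟩ := hmid p p.2
      have hfp : f p = if b p then 1 else -1 := hfb p
      simp only [gapAt, hfp, signReal_signPlus, sub_nonneg, m1, not_le.2 m2, if_true, if_false]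
      by_cases hb : b p <;> simp [hb, signReal, outcome] <;> norm_num
  linarith

/-- Shattered sets contained in an interval of length `1/8` can be moved near `1/2`. -/
lemma exists_shatters_near_half {K : Set (unitInterval → unitInterval)}
    (hK : IsValidPostProcessing K) {T S : Finset unitInterval} (hsh : Shatters (thr K) S)
    (hTS : T ⊆ S) {c : ℝ} (hc : ∀ p ∈ T, c ≤ (p : ℝ) ∧ (p : ℝ) < c + 1 / 8) :
    ∃ T' : Finset unitInterval, T'.card = T.card ∧ Shatters (thr K) T' ∧
      ∀ p ∈ T', (7 / 16 : ℝ) ≤ p ∧ (p : ℝ) < 9 / 16 := by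
  classical
  set φ : unitInterval → unitInterval := fun p => clamp ((p : ℝ) - c + 7 / 16) with hφ
  have hφv : ∀ p ∈ T, (φ p : ℝ) = p - c + 7 / 16 := by
    intro p hp
    obtain ⟨h1, h2⟩ := hc p hp
    simp only [hφ, clamp]
    rw [Set.projIcc_of_mem _ (Set.mem_Icc.2 ⟨by linarith, by linarith⟩)]
  have hinj : Set.InjOn φ T := by
    intro p hp q hq h
    have := congrArg (fun x : unitInterval => (x : ℝ)) h
    simp only [hφv p hp, hφv q hq] at this
    exact Subtype.ext (by linarith)
  refine ⟨T.image φ, Finset.card_image_of_injOn hinj, fun g => ?_, fun p hp => ?_⟩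
  · have hmem : ∀ p ∈ T, φ p ∈ ((T.image φ : Finset unitInterval) : Set unitInterval) := fun p hp =>
      Finset.mem_coe.2 (Finset.mem_image_of_mem φ hp)
    obtain ⟨f, ⟨k, hk, rfl⟩, hf⟩ := hsh fun p =>
      if h : (p : unitInterval) ∈ T then g ⟨φ p, hmem p h⟩ else 1
    -- The input shift undoes `φ`, so the new function has on `φ p` the value of the old one on `p`;
    -- truncation has no effect there.
    refine ⟨_, ⟨_, hK.translation (c - 7 / 16) 0 k hk, rfl⟩, ?_⟩
    rintro ⟨p', hp'⟩
    obtain ⟨p, hp, rfl⟩ := Finset.mem_image.1 (Finset.mem_coe.1 hp')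
    have h1 := hf ⟨p, hTS hp⟩
    simp only [hp, dif_pos] at h1
    rw [← h1]
    simp only [translatePost, hφv p hp]
    have e1 : clamp ((p : ℝ) - c + 7 / 16 + (c - 7 / 16)) = p := by
      rw [show (p : ℝ) - c + 7 / 16 + (c - 7 / 16) = p by ring]
      exact Set.projIcc_val _ p
    have e2 : clamp ((k p : ℝ) + 0) = k p := by
      rw [add_zero]
      exact Set.projIcc_val _ (k p)
    rw [e1, e2]
  · obtain ⟨q, hq, rfl⟩ := Finset.mem_image.1 hp
    obtain ⟨h1, h2⟩ := hc q hq
    rw [hφv q hq]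
    constructor <;> linarith

/-- Acceptance is at least `2/3` under calibrated labels and at most `1/3` under every labelling, so
the collision error `m² / |S|` must be at least `1/3`. -/
lemma card_le_of_isAuditor_of_near_half {K : Set (unitInterval → unitInterval)}
    (hK : IsValidPostProcessing K) (hm : ∀ k ∈ K, Measurable k) {m : ℕ} {A : RandomizedTest m}
    (hA : IsAuditor K (1 / 8) 0 A) (hsh : Shatters (thr K) S)
    (hmid : ∀ p ∈ S, (7 / 16 : ℝ) ≤ p ∧ (p : ℝ) < 9 / 16) : S.card ≤ 3 * m ^ 2 := by
  rcases S.eq_empty_or_nonempty with rfl | hS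
  · simp
  have hd0 : (0 : ℝ) < S.card := by exact_mod_cast hS.card_pos
  have hw := isLabelWeight_calibratedWeight (S := S)
  have h1 : 2 / 3 ≤ A.probAccept (exampleLaw S calibratedWeight) :=
    (hA _ (isProbabilityMeasure_exampleLaw hS hw)).2
      (by rw [ece_exampleLaw_calibratedWeight hS]; norm_num)
  have h2 : ∀ b : S → Bool, A.probAccept (exampleLaw S (labelWeight b)) ≤ 1 / 3 := by
    intro b
    have := isProbabilityMeasure_exampleLaw hS (isLabelWeight_labelWeight b)
    have h3 := (hA _ this).1 (lt_cdl_exampleLaw_labelWeight hK hm hS hsh hmid b)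
    have h4 := probAccept_add_probReject A (exampleLaw S (labelWeight b))
    linarith
  have h5 := probAccept_le_of_forall_labelWeight hS hw A h2
  have h6 : 1 / 3 ≤ (m : ℝ) ^ 2 / S.card := by linarith
  rw [le_div_iff₀ hd0] at h6
  have h7 : (S.card : ℝ) ≤ 3 * (m : ℝ) ^ 2 := by linarith
  exact_mod_cast h7

/-- The size of a set shattered by `thr K` is at most quadratic in the size of an auditor. -/
lemma card_le_of_isAuditor {K : Set (unitInterval → unitInterval)}
    (hK : IsValidPostProcessing K) (hm : ∀ k ∈ K, Measurable k) {m : ℕ} {A : RandomizedTest m}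
    (hA : IsAuditor K (1 / 8) 0 A) (hsh : Shatters (thr K) S) : S.card ≤ (6 * m) ^ 2 := by
  classical
  by_contra! hcon
  -- There are nine boxes of length `1/8` because `p = 1` falls in its own. As `9 * 3 m² ≤ 36 m²`,
  -- some box holds more than `3 m²` points.
  have hbox : ∀ p ∈ S, ⌊8 * (p : ℝ)⌋₊ ∈ Finset.range 9 := by
    intro p _
    rw [Finset.mem_range, Nat.floor_lt' (by norm_num)]
    have := p.2.2
    norm_num
    linarith
  obtain ⟨k, -, hk⟩ := Finset.exists_lt_card_fiber_of_mul_lt_card_of_maps_to hbox (n := 3 * m ^ 2)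
    (by rw [Finset.card_range]; nlinarith)
  obtain ⟨T, hT, hTsh, hTmid⟩ := exists_shatters_near_half hK hsh
    (Finset.filter_subset (fun p : unitInterval => ⌊8 * (p : ℝ)⌋₊ = k) S) (c := k / 8) (by
      intro p hp
      have hp0 : 0 ≤ 8 * (p : ℝ) := mul_nonneg (by norm_num) p.2.1
      have := (Nat.floor_eq_iff hp0).1 (Finset.mem_filter.1 hp).2
      constructor <;> linarith [this.1, this.2])
  have := card_le_of_isAuditor_of_near_half hK hm hA hTsh hTmid
  omega

/-- Stated in `ℝ≥0∞`, the bound also covers infinite VC dimension, where it excludes every finite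
`m`. -/
theorem auditor_lower_bound {K : Set (unitInterval → unitInterval)}
    (hK : IsValidPostProcessing K) (hm : ∀ k ∈ K, Measurable k) {m : ℕ} {A : RandomizedTest m}
    (hA : IsAuditor K (1 / 8) 0 A) :
    ENNReal.ofReal (1 / 6) * (vcDim (thr K) : ℝ≥0∞) ^ (1 / 2 : ℝ) ≤ (m : ℝ≥0∞) := by
  have h1 : vcDim (thr K) ≤ (((6 * m) ^ 2 : ℕ) : ℕ∞) :=
    iSup₂_le fun S hS => by exact_mod_cast card_le_of_isAuditor hK hm hA hS
  have h2 : (vcDim (thr K) : ℝ≥0∞) ≤ ((6 * m : ℕ) : ℝ≥0∞) ^ (2 : ℝ) := by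
    refine (ENat.toENNReal_le.2 h1).trans (le_of_eq ?_)
    rw [ENat.toENNReal_coe, ENNReal.rpow_ofNat]
    push_cast
    rfl
  have h3 := ENNReal.rpow_le_rpow h2 (by norm_num : (0 : ℝ) ≤ 1 / 2)
  rw [← ENNReal.rpow_mul, show (2 : ℝ) * (1 / 2) = 1 by norm_num, ENNReal.rpow_one] at h3
  calc _ ≤ ENNReal.ofReal (1 / 6) * ((6 * m : ℕ) : ℝ≥0∞) := by gcongr
    _ = m := by
      rw [← ENNReal.ofReal_natCast, ← ENNReal.ofReal_mul (by norm_num), ← ENNReal.ofReal_natCast]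
      congr 1
      push_cast
      ring

end

end CalDecisionLoss

theorem mainTheorem1 :
    (∃ C : ℝ, 0 < C ∧
      ∀ K : Set (unitInterval → unitInterval),
        CalDecisionLoss.IsValidPostProcessing K →
        (∀ k ∈ K, Measurable k) →
        CalDecisionLoss.IsMeasurableClass (CalDecisionLoss.thr K) →
        ∀ d : ℕ, CalDecisionLoss.vcDim (CalDecisionLoss.thr K) = (d : ℕ∞) →
        ∀ α ε : ℝ, 0 < α → α < 1 → 0 < ε → ε < 1 →
          ∃ m : ℕ, (m : ℝ) ≤ C * ((d : ℝ) * Real.log (2 / ε) / ε ^ 2) ∧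
            ∃ A : CalDecisionLoss.RandomizedTest m,
              CalDecisionLoss.IsTester K α (α - ε) A) ∧
    (∃ c : ℝ, 0 < c ∧
      ∀ K : Set (unitInterval → unitInterval),
        CalDecisionLoss.IsValidPostProcessing K →
        (∀ k ∈ K, Measurable k) →
        ∀ (m : ℕ) (A : CalDecisionLoss.RandomizedTest m),
          CalDecisionLoss.IsAuditor K (1 / 8) 0 A →
          ENNReal.ofReal c *
            (CalDecisionLoss.vcDim (CalDecisionLoss.thr K) : ℝ≥0∞) ^ (1 / 2 : ℝ) ≤
              (m : ℝ≥0∞)) := by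
  refine ⟨⟨40000, by norm_num, fun K hK hm hC d hd α ε _ _ hε hε1 => ?_⟩,
    ⟨1 / 6, by norm_num, fun K hK hm m A hA => ?_⟩⟩
  · exact CalDecisionLoss.exists_tester hK hm hC hd α hε hε1
  · exact CalDecisionLoss.auditor_lower_bound hK hm hA
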